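/- Let $K$ be a field and let $0\le n\le \ell$ be integers. Let $\mathscr H_{\ell,n}^{(0)}$ be the cyclotomic nilHecke algebra of type $A$: the unital associative $K$-algebra generated by $\psi_1,\dots,\psi_{n-1},y_1,\dots,y_n$ with relations $\psi_r^2=0$; $\psi_r\psi_k=\psi_k\psi_r$ for $|r-k|>1$; $\psi_r\psi_{r+1}\psi_r=\psi_{r+1}\psi_r\psi_{r+1}$; $y_iy_j=y_jy_i$; $\psi_ry_i=y_i\psi_r$ for $i\ne r,r+1$; $\psi_ry_{r+1}=y_r\psi_r+1$; $y_{r+1}\psi_r=\psi_ry_r+1$; and $y_1^{\ell}=0$ (if $n=0$ there are no generators and the algebra is $K$). It is $\mathbb Z$-graded by $\deg\psi_r=-2$, $\deg y_i=2$. Let $\ast$ be the $K$-linear anti-automorphism fixing all $\psi_r$ and $y_i$. Let $\mathfrak S_n$ be the symmetric group with simple transpositions $s_r=(r,r+1)$, length function $\ell(\cdot)$ and longest element $w_0$. For $w\in\mathfrak S_n$ put $\psi_w=\psi_{i_1}\cdots\psi_{i_k}$, where $w=s_{i_1}\cdots s_{i_k}$ is a reduced expression. For an $\ell$-tuple $\lambda$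 with entries in $\{\emptyset,(1)\}$ having exactly $n$ entries $(1)$, in positions $k_1<\dots<k_n$, put $y_\lambda=y_1^{\ell-k_1}\cdots y_n^{\ell-k_n}$ and $\psi^\lambda_{w,u}=\psi_w^\ast\, y_\lambda\,\psi_u$. Let $\lambda_{\min}$ be the tuple whose last $n$ entries are $(1)$ (so $y_{\lambda_{\min}}=y_1^{n-1}y_2^{n-2}\cdots y_{n-1}$), and for $z_1,z_2\in\mathfrak S_n$ define $$F_{z_1,z_2}=(-1)^{n(n-1)/2}\,\psi^{\lambda_{\min}}_{w_0z_1,z_2}\in\mathscr H_{\ell,n}^{(0)}.$$ Then for all $z_1,z_2\in\mathfrak S_n$ the element $F_{z_1,z_2}$ is nonzero and homogeneous of degree $2\ell(z_1)-2\ell(z_2)$. If moreover $\ell=n$, then $$\sum_{w\in\mathfrak S_n}F_{w,w}=1,\qquad F_{z_1,z_2}F_{u_1,u_2}=\delta_{z_2,u_1}F_{z_1,u_2}\quad\text{for all }z_1,z_2,u_1,u_2\in\mathfrak S_n,$$ and there are a bijection $e:\mathfrak S_n\to\{1,\dots,n!\}$ and a $K$-algebra isomorphism $\mathscr H_{n,n}^{(0)}\cong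 M_{n!\times n!}(K)$ that sends $F_{u,w}$ to the matrix unit $E_{e(u),e(w)}$ for all $u,w\in\mathfrak S_n$; that is, $\{F_{u,w}\}$ is a complete set of matrix units. -/

import Mathlib

open scoped Nat DirectSum

/-! ## The symmetric group: simple reflections, length, longest element -/

/-- The index `r` of the `r`-th simple reflection, seen as a point of `{1, …, n}`
(everything is indexed from `0`). -/
def loIdx {n : ℕ} (r : Fin (n - 1)) : Fin n := ⟨r.1, by have := r.2; omega⟩

/-- The point `r + 1`. -/
def hiIdx {n : ℕ} (r : Fin (n - 1)) : Fin n := ⟨r.1 + 1, by have := r.2; omega⟩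

/-- The simple transposition `s_r = (r, r + 1)`. -/
def simpleRefl {n : ℕ} (r : Fin (n - 1)) : Equiv.Perm (Fin n) :=
  Equiv.swap (loIdx r) (hiIdx r)

/-- `L` is an expression of `w` as a product of simple transpositions. -/
def IsExpr {n : ℕ} (w : Equiv.Perm (Fin n)) (L : List (Fin (n - 1))) : Prop :=
  (L.map simpleRefl).prod = w

theorem exists_isExpr {n : ℕ} (w : Equiv.Perm (Fin n)) :
    ∃ L : List (Fin (n - 1)), IsExpr w L := by
  rcases n with _ | m
  · exact ⟨[], Subsingleton.elim _ _⟩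
  · have hw : w ∈ Submonoid.closure
        (Set.range fun i : Fin m => Equiv.swap i.castSucc i.succ) := by
      rw [Equiv.Perm.mclosure_swap_castSucc_succ]; trivial
    induction hw using Submonoid.closure_induction with
    | mem x hx =>
      obtain ⟨i, rfl⟩ := hx
      exact ⟨[i], by simp [IsExpr, simpleRefl, loIdx, hiIdx]; rfl⟩
    | one => exact ⟨[], rfl⟩
    | mul x y _ _ hx hy =>
      obtain ⟨L, hL⟩ := hx
      obtain ⟨M, hM⟩ := hy
      refine ⟨L ++ M, ?_⟩
      unfold IsExpr at *
      rw [List.map_append, List.prod_append, hL, hM]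

/-- The length of `w`: the least number of factors in an expression of `w`. -/
noncomputable def permLength {n : ℕ} (w : Equiv.Perm (Fin n)) : ℕ :=
  sInf {k : ℕ | ∃ L : List (Fin (n - 1)), IsExpr w L ∧ L.length = k}

/-- Reduced expressions. -/
def IsReducedExpr {n : ℕ} (w : Equiv.Perm (Fin n)) (L : List (Fin (n - 1))) : Prop :=
  IsExpr w L ∧ L.length = permLength w

theorem exists_isReducedExpr {n : ℕ} (w : Equiv.Perm (Fin n)) :
    ∃ L : List (Fin (n - 1)), IsReducedExpr w L := by
  obtain ⟨L, hL⟩ := exists_isExpr w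
  exact Nat.sInf_mem
    (s := {k : ℕ | ∃ L : List (Fin (n - 1)), IsExpr w L ∧ L.length = k}) ⟨_, L, hL, rfl⟩

/-- A reduced expression of `w`. -/
noncomputable def reducedExpr {n : ℕ} (w : Equiv.Perm (Fin n)) : List (Fin (n - 1)) :=
  Classical.choose (exists_isReducedExpr w)

theorem reducedExpr_spec {n : ℕ} (w : Equiv.Perm (Fin n)) :
    IsReducedExpr w (reducedExpr w) :=
  Classical.choose_spec (exists_isReducedExpr w)

theorem exists_longest (n : ℕ) :
    ∃ w : Equiv.Perm (Fin n), ∀ u : Equiv.Perm (Fin n), permLength u ≤ permLength w :=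
  Finite.exists_max permLength

/-- The longest element `w₀` of the symmetric group. -/
noncomputable def longestPerm (n : ℕ) : Equiv.Perm (Fin n) :=
  Classical.choose (exists_longest n)

theorem permLength_le_longestPerm {n : ℕ} (u : Equiv.Perm (Fin n)) :
    permLength u ≤ permLength (longestPerm n) :=
  Classical.choose_spec (exists_longest n) u

/-! ## The cyclotomic nilHecke algebra -/

/-- The generators `ψ_1, …, ψ_{n-1}, y_1, …, y_n`. -/
inductive NilHeckeGen (n : ℕ) : Type
  | psi (r : Fin (n - 1)) : NilHeckeGen n
  | y (i : Fin n) : NilHeckeGen n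

/-- The generator `ψ_r` of the free algebra. -/
def freePsi (K : Type*) [Field K] {n : ℕ} (r : Fin (n - 1)) : FreeAlgebra K (NilHeckeGen n) :=
  FreeAlgebra.ι K (NilHeckeGen.psi r)

/-- The generator `y_i` of the free algebra. -/
def freeY (K : Type*) [Field K] {n : ℕ} (i : Fin n) : FreeAlgebra K (NilHeckeGen n) :=
  FreeAlgebra.ι K (NilHeckeGen.y i)

/-- The defining relations of the cyclotomic nilHecke algebra: the relations of the nilHecke
algebra together with `y_1 ^ ℓ = 0`. -/
inductive CycloNilHeckeRel (K : Type*) [Field K] (ℓ n : ℕ) :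
    FreeAlgebra K (NilHeckeGen n) → FreeAlgebra K (NilHeckeGen n) → Prop
  | psi_sq (r : Fin (n - 1)) :
      CycloNilHeckeRel K ℓ n (freePsi K r * freePsi K r) 0
  | psi_comm (r k : Fin (n - 1)) (h : k.1 + 1 < r.1) :
      CycloNilHeckeRel K ℓ n (freePsi K r * freePsi K k) (freePsi K k * freePsi K r)
  | braid (r k : Fin (n - 1)) (h : k.1 = r.1 + 1) :
      CycloNilHeckeRel K ℓ n (freePsi K r * freePsi K k * freePsi K r)
        (freePsi K k * freePsi K r * freePsi K k)
  | y_comm (i j : Fin n) :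
      CycloNilHeckeRel K ℓ n (freeY K i * freeY K j) (freeY K j * freeY K i)
  | psi_y_far (r : Fin (n - 1)) (i : Fin n) (h₁ : i ≠ loIdx r) (h₂ : i ≠ hiIdx r) :
      CycloNilHeckeRel K ℓ n (freePsi K r * freeY K i) (freeY K i * freePsi K r)
  | psi_y (r : Fin (n - 1)) :
      CycloNilHeckeRel K ℓ n (freePsi K r * freeY K (hiIdx r))
        (freeY K (loIdx r) * freePsi K r + 1)
  | y_psi (r : Fin (n - 1)) :
      CycloNilHeckeRel K ℓ n (freeY K (hiIdx r) * freePsi K r)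
        (freePsi K r * freeY K (loIdx r) + 1)
  | cyclotomic (i : Fin n) (h : i.1 = 0) :
      CycloNilHeckeRel K ℓ n (freeY K i ^ ℓ) 0

/-- The cyclotomic nilHecke algebra `ℋ_{ℓ,n}^{(0)}` of type `A` over `K`. -/
abbrev CycloNilHecke (K : Type*) [Field K] (ℓ n : ℕ) : Type _ :=
  RingQuot (CycloNilHeckeRel K ℓ n)

namespace CycloNilHecke

variable (K : Type*) [Field K] (ℓ : ℕ) {n : ℕ}

/-- The image of a generator in the cyclotomic nilHecke algebra. -/
noncomputable def gen (g : NilHeckeGen n) : CycloNilHecke K ℓ n :=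
  RingQuot.mkAlgHom K (CycloNilHeckeRel K ℓ n) (FreeAlgebra.ι K g)

/-- `ψ_r`. -/
noncomputable def psi (r : Fin (n - 1)) : CycloNilHecke K ℓ n := gen K ℓ (.psi r)

/-- `y_i`. -/
noncomputable def y (i : Fin n) : CycloNilHecke K ℓ n := gen K ℓ (.y i)

theorem mk_freePsi (r : Fin (n - 1)) :
    RingQuot.mkAlgHom K (CycloNilHeckeRel K ℓ n) (freePsi K r) = psi K ℓ r := rfl

theorem mk_freeY (i : Fin n) :
    RingQuot.mkAlgHom K (CycloNilHeckeRel K ℓ n) (freeY K i) = y K ℓ i := rfl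

theorem psi_sq (r : Fin (n - 1)) : psi K ℓ r * psi K ℓ r = 0 := by
  simpa [mk_freePsi, mk_freeY] using
    RingQuot.mkAlgHom_rel K (CycloNilHeckeRel.psi_sq (K := K) (ℓ := ℓ) r)

theorem psi_comm (r k : Fin (n - 1)) (h : k.1 + 1 < r.1) :
    psi K ℓ r * psi K ℓ k = psi K ℓ k * psi K ℓ r := by
  simpa [mk_freePsi, mk_freeY] using
    RingQuot.mkAlgHom_rel K (CycloNilHeckeRel.psi_comm (K := K) (ℓ := ℓ) r k h)

theorem braid (r k : Fin (n - 1)) (h : k.1 = r.1 + 1) :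
    psi K ℓ r * psi K ℓ k * psi K ℓ r = psi K ℓ k * psi K ℓ r * psi K ℓ k := by
  simpa [mk_freePsi, mk_freeY] using
    RingQuot.mkAlgHom_rel K (CycloNilHeckeRel.braid (K := K) (ℓ := ℓ) r k h)

theorem y_comm (i j : Fin n) : y K ℓ i * y K ℓ j = y K ℓ j * y K ℓ i := by
  simpa [mk_freePsi, mk_freeY] using
    RingQuot.mkAlgHom_rel K (CycloNilHeckeRel.y_comm (K := K) (ℓ := ℓ) i j)

theorem psi_y_far (r : Fin (n - 1)) (i : Fin n) (h₁ : i ≠ loIdx r) (h₂ : i ≠ hiIdx r) :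
    psi K ℓ r * y K ℓ i = y K ℓ i * psi K ℓ r := by
  simpa [mk_freePsi, mk_freeY] using
    RingQuot.mkAlgHom_rel K (CycloNilHeckeRel.psi_y_far (K := K) (ℓ := ℓ) r i h₁ h₂)

theorem psi_y (r : Fin (n - 1)) :
    psi K ℓ r * y K ℓ (hiIdx r) = y K ℓ (loIdx r) * psi K ℓ r + 1 := by
  simpa [mk_freePsi, mk_freeY] using
    RingQuot.mkAlgHom_rel K (CycloNilHeckeRel.psi_y (K := K) (ℓ := ℓ) r)

theorem y_psi (r : Fin (n - 1)) :
    y K ℓ (hiIdx r) * psi K ℓ r = psi K ℓ r * y K ℓ (loIdx r) + 1 := by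
  simpa [mk_freePsi, mk_freeY] using
    RingQuot.mkAlgHom_rel K (CycloNilHeckeRel.y_psi (K := K) (ℓ := ℓ) r)

theorem cyclotomic (i : Fin n) (h : i.1 = 0) : y K ℓ i ^ ℓ = 0 := by
  simpa [mk_freePsi, mk_freeY] using
    RingQuot.mkAlgHom_rel K (CycloNilHeckeRel.cyclotomic (K := K) (ℓ := ℓ) i h)

/-! ### The anti-automorphism `*` -/

/-- The anti-automorphism `*`, as a homomorphism to the opposite algebra. -/
noncomputable def starHom : CycloNilHecke K ℓ n →ₐ[K] (CycloNilHecke K ℓ n)ᵐᵒᵖ :=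
  RingQuot.liftAlgHom K ⟨FreeAlgebra.lift K fun g => MulOpposite.op (gen K ℓ g), by
    have hp : ∀ r : Fin (n - 1), FreeAlgebra.lift K
        (fun g => MulOpposite.op (gen K ℓ g)) (freePsi K r) = MulOpposite.op (psi K ℓ r) :=
      fun r => FreeAlgebra.lift_ι_apply _ _
    have hy : ∀ i : Fin n, FreeAlgebra.lift K
        (fun g => MulOpposite.op (gen K ℓ g)) (freeY K i) = MulOpposite.op (y K ℓ i) :=
      fun i => FreeAlgebra.lift_ι_apply _ _
    intro a b h
    induction h with
    | psi_sq r => simp [hp, ← MulOpposite.op_mul, psi_sq]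
    | psi_comm r k h => simp [hp, ← MulOpposite.op_mul, psi_comm K ℓ r k h]
    | braid r k h => simp [hp, ← MulOpposite.op_mul, ← mul_assoc, braid K ℓ r k h]
    | y_comm i j => simp [hy, ← MulOpposite.op_mul, y_comm K ℓ i j]
    | psi_y_far r i h₁ h₂ => simp [hp, hy, ← MulOpposite.op_mul, psi_y_far K ℓ r i h₁ h₂]
    | psi_y r => simp [hp, hy, ← MulOpposite.op_mul, y_psi K ℓ r]
    | y_psi r => simp [hp, hy, ← MulOpposite.op_mul, psi_y K ℓ r]
    | cyclotomic i h => simp [hy, ← MulOpposite.op_pow, cyclotomic K ℓ i h]⟩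

/-- The unique `K`-linear anti-automorphism `*` fixing all `ψ_r` and all `y_i`. -/
noncomputable def antiStar (x : CycloNilHecke K ℓ n) : CycloNilHecke K ℓ n :=
  MulOpposite.unop (starHom K ℓ x)

theorem antiStar_gen (g : NilHeckeGen n) : antiStar K ℓ (gen K ℓ g) = gen K ℓ g := by
  simp [antiStar, starHom, gen]

theorem antiStar_mul (a b : CycloNilHecke K ℓ n) :
    antiStar K ℓ (a * b) = antiStar K ℓ b * antiStar K ℓ a := by
  simp [antiStar]

/-! ### The grading -/

/-- `deg ψ_r = -2`, `deg y_i = 2`. -/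
def genDeg : NilHeckeGen n → ℤ
  | .psi _ => -2
  | .y _ => 2

/-- The homogeneous component of degree `d`: the span of the monomials of degree `d` in the
generators. -/
noncomputable def gradedPart (n : ℕ) (d : ℤ) : Submodule K (CycloNilHecke K ℓ n) :=
  Submodule.span K {x | ∃ L : List (NilHeckeGen n),
    (L.map genDeg).sum = d ∧ (L.map (gen K ℓ)).prod = x}

theorem gen_mem (g : NilHeckeGen n) : gen K ℓ g ∈ gradedPart K ℓ n (genDeg g) :=
  Submodule.subset_span ⟨[g], by simp, by simp⟩

instance gradedPart_gradedMonoid : SetLike.GradedMonoid (gradedPart K ℓ n) where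
  one_mem := Submodule.subset_span ⟨[], by simp, by simp⟩
  mul_mem := by
    intro i j a b ha hb
    have h := Submodule.mul_mem_mul ha hb
    refine (?_ : gradedPart K ℓ n i * gradedPart K ℓ n j ≤ gradedPart K ℓ n (i + j)) h
    unfold gradedPart
    rw [Submodule.span_mul_span, Submodule.span_le]
    rintro _ ⟨_, ⟨L, hL, rfl⟩, _, ⟨M, hM, rfl⟩, rfl⟩
    exact Submodule.subset_span ⟨L ++ M, by simp [hL, hM], by simp⟩

theorem of_congr {i j : ℤ} (h : i = j) (a : gradedPart K ℓ n i) (b : gradedPart K ℓ n j)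
    (hab : (a : CycloNilHecke K ℓ n) = b) :
    DirectSum.of (fun d => gradedPart K ℓ n d) i a =
      DirectSum.of (fun d => gradedPart K ℓ n d) j b := by
  subst h
  congr 1
  exact Subtype.ext hab

/-- A generator, as an element of the direct sum of the homogeneous components. -/
noncomputable def ofGen (g : NilHeckeGen n) : ⨁ d, gradedPart K ℓ n d :=
  DirectSum.of (fun d => gradedPart K ℓ n d) (genDeg g) ⟨gen K ℓ g, gen_mem K ℓ g⟩

theorem ofGen_list (L : List (NilHeckeGen n)) :
    (L.map (ofGen K ℓ)).prod =
      DirectSum.of (fun d => gradedPart K ℓ n d) (L.map genDeg).sum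
        ⟨(L.map (gen K ℓ)).prod, Submodule.subset_span ⟨L, rfl, rfl⟩⟩ := by
  induction L with
  | nil => rfl
  | cons g L ih =>
    rw [List.map_cons, List.prod_cons, ih, ofGen, DirectSum.of_mul_of]
    exact of_congr K ℓ (by simp) _ _ (by simp [GradedMonoid.GMul.mul])

theorem ofGen_list_congr (L M : List (NilHeckeGen n))
    (hd : (L.map genDeg).sum = (M.map genDeg).sum)
    (h : (L.map (gen K ℓ)).prod = (M.map (gen K ℓ)).prod) :
    (L.map (ofGen K ℓ)).prod = (M.map (ofGen K ℓ)).prod := by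
  rw [ofGen_list, ofGen_list]
  exact of_congr K ℓ hd _ _ h

theorem ofGen_list_zero (L : List (NilHeckeGen n)) (h : (L.map (gen K ℓ)).prod = 0) :
    (L.map (ofGen K ℓ)).prod = 0 := by
  rw [ofGen_list]
  simp only [h]
  exact map_zero (DirectSum.of (fun d => gradedPart K ℓ n d) _)

theorem ofGen_list_add_one (L M : List (NilHeckeGen n))
    (hL : (L.map genDeg).sum = 0) (hM : (M.map genDeg).sum = 0)
    (h : (L.map (gen K ℓ)).prod = (M.map (gen K ℓ)).prod + 1) :
    (L.map (ofGen K ℓ)).prod = (M.map (ofGen K ℓ)).prod + 1 := by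
  have h1 : (1 : ⨁ d, gradedPart K ℓ n d) =
      DirectSum.of (fun d => gradedPart K ℓ n d) 0 ⟨1, SetLike.GradedOne.one_mem⟩ := rfl
  rw [ofGen_list, ofGen_list, h1,
    of_congr K ℓ hM _ ⟨(M.map (gen K ℓ)).prod, Submodule.subset_span ⟨M, hM, rfl⟩⟩ rfl,
    ← map_add]
  exact of_congr K ℓ hL _ _ h

/-- The decomposition map of the grading. -/
noncomputable def decomposeHom : CycloNilHecke K ℓ n →ₐ[K] ⨁ d, gradedPart K ℓ n d :=
  RingQuot.liftAlgHom K ⟨FreeAlgebra.lift K (ofGen K ℓ), by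
    have hp : ∀ r : Fin (n - 1), FreeAlgebra.lift K
        (ofGen K ℓ) (freePsi K r) = ofGen K ℓ (.psi r) :=
      fun r => FreeAlgebra.lift_ι_apply _ _
    have hy : ∀ i : Fin n, FreeAlgebra.lift K
        (ofGen K ℓ) (freeY K i) = ofGen K ℓ (.y i) :=
      fun i => FreeAlgebra.lift_ι_apply _ _
    intro a b h
    induction h with
    | psi_sq r =>
      simpa [hp] using ofGen_list_zero K ℓ [.psi r, .psi r] (by simpa [psi, y] using psi_sq K ℓ r)
    | psi_comm r k h =>
      simpa [hp] using ofGen_list_congr K ℓ [.psi r, .psi k] [.psi k, .psi r]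
        (by simp [genDeg]) (by simpa [psi, y] using psi_comm K ℓ r k h)
    | braid r k h =>
      simpa [hp, mul_assoc] using ofGen_list_congr K ℓ [.psi r, .psi k, .psi r]
        [.psi k, .psi r, .psi k]
        (by simp [genDeg]) (by simpa [psi, y, mul_assoc] using braid K ℓ r k h)
    | y_comm i j =>
      simpa [hy] using ofGen_list_congr K ℓ [.y i, .y j] [.y j, .y i]
        (by simp [genDeg]) (by simpa [psi, y] using y_comm K ℓ i j)
    | psi_y_far r i h₁ h₂ =>
      simpa [hp, hy] using ofGen_list_congr K ℓ [.psi r, .y i] [.y i, .psi r]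
        (by simp [genDeg]) (by simpa [psi, y] using psi_y_far K ℓ r i h₁ h₂)
    | psi_y r =>
      simpa [hp, hy] using ofGen_list_add_one K ℓ [.psi r, .y (hiIdx r)] [.y (loIdx r), .psi r]
        (by simp [genDeg]) (by simp [genDeg]) (by simpa [psi, y] using psi_y K ℓ r)
    | y_psi r =>
      simpa [hp, hy] using ofGen_list_add_one K ℓ [.y (hiIdx r), .psi r] [.psi r, .y (loIdx r)]
        (by simp [genDeg]) (by simp [genDeg]) (by simpa [psi, y] using y_psi K ℓ r)
    | cyclotomic i h =>
      simpa [hy] using ofGen_list_zero K ℓ (List.replicate ℓ (.y i))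
        (by simpa [psi, y] using cyclotomic K ℓ i h)⟩

theorem decomposeHom_gen (g : NilHeckeGen n) : decomposeHom K ℓ (gen K ℓ g) = ofGen K ℓ g := by
  simp [decomposeHom, gen]

/-- The `ℤ`-grading of the cyclotomic nilHecke algebra. -/
noncomputable instance gradedPart_gradedAlgebra : GradedAlgebra (gradedPart K ℓ n) :=
  GradedAlgebra.ofAlgHom (gradedPart K ℓ n) (decomposeHom K ℓ)
    (by
      refine RingQuot.ringQuot_ext' K _ _ (FreeAlgebra.hom_ext (funext fun g => ?_))
      change DirectSum.coeAlgHom (gradedPart K ℓ n) (decomposeHom K ℓ (gen K ℓ g)) = gen K ℓ g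
      rw [decomposeHom_gen, ofGen, DirectSum.coeAlgHom_of])
    (by
      rintro d ⟨x, hx⟩
      suffices H : ∀ hx' : x ∈ gradedPart K ℓ n d, decomposeHom K ℓ x =
          DirectSum.of (fun d => gradedPart K ℓ n d) d ⟨x, hx'⟩ from H hx
      refine Submodule.span_induction (p := fun x _ => ∀ hx' : x ∈ gradedPart K ℓ n d,
        decomposeHom K ℓ x = DirectSum.of (fun d => gradedPart K ℓ n d) d ⟨x, hx'⟩)
        ?_ ?_ ?_ ?_ hx
      · rintro _ ⟨L, rfl, rfl⟩ hx'
        rw [map_list_prod, List.map_map, ← ofGen_list]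
        congr 1
        exact List.map_congr_left fun g _ => decomposeHom_gen K ℓ g
      · intro _
        rw [map_zero]
        exact (map_zero (DirectSum.of (fun d => gradedPart K ℓ n d) d)).symm
      · intro a b ha hb iha ihb _
        rw [map_add, iha ha, ihb hb, ← map_add]
        rfl
      · intro c a ha iha _
        rw [map_smul, iha ha]
        exact (map_smul (DirectSum.lof K ℤ (fun d => gradedPart K ℓ n d) d) c ⟨a, ha⟩).symm)

/-! ### The cellular basis elements -/

/-- `ψ_w := ψ_{i_1} ⋯ ψ_{i_k}` for a reduced expression `w = s_{i_1} ⋯ s_{i_k}`. -/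
noncomputable def psiPerm (w : Equiv.Perm (Fin n)) : CycloNilHecke K ℓ n :=
  ((reducedExpr w).map (psi K ℓ)).prod

end CycloNilHecke

/-- The set `𝒫₀` of `ℓ`-tuples `(λ⁽¹⁾, …, λ⁽ˡ⁾)` with entries in `{∅, (1)}` and exactly `n`
entries `(1)`; such a tuple is recorded as the set of the positions of its entries `(1)`. -/
def OneBoxShape (ℓ n : ℕ) : Type := {S : Finset (Fin ℓ) // S.card = n}

namespace OneBoxShape

variable {ℓ n : ℕ}

/-- `θ(λ) = (k_1 < ⋯ < k_n)`, the positions of the entries `(1)`, counted from `1` to `ℓ`. -/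
def theta (S : OneBoxShape ℓ n) (i : Fin n) : ℕ := (S.1.orderEmbOfFin S.2 i : ℕ) + 1

/-- `λ_min = (∅, …, ∅, (1), …, (1))`, with `ℓ - n` entries `∅` followed by `n` entries `(1)`. -/
def lamMin (h : n ≤ ℓ) : OneBoxShape ℓ n :=
  ⟨Finset.univ.filter fun j : Fin ℓ => ℓ - n ≤ (j : ℕ), by
    have e : (Finset.univ.filter fun j : Fin ℓ => ℓ - n ≤ (j : ℕ)) =
        Finset.univ.image fun i : Fin n => (⟨ℓ - n + i, by omega⟩ : Fin ℓ) := by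
      ext j
      simp only [Finset.mem_filter, Finset.mem_univ, true_and, Finset.mem_image]
      constructor
      · intro hj
        exact ⟨⟨(j : ℕ) - (ℓ - n), by omega⟩, Fin.ext (Nat.add_sub_cancel' hj)⟩
      · rintro ⟨i, rfl⟩
        exact Nat.le_add_right _ _
    rw [e, Finset.card_image_of_injective _ fun a b hab => by simpa [Fin.ext_iff] using hab,
      Finset.card_univ, Fintype.card_fin]⟩

end OneBoxShape

namespace CycloNilHecke

variable (K : Type*) [Field K] (ℓ : ℕ) {n : ℕ}

/-- `y_λ := y_1 ^ (ℓ - k_1) ⋯ y_n ^ (ℓ - k_n)`, where `θ(λ) = (k_1, …, k_n)`. -/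
noncomputable def yShape (S : OneBoxShape ℓ n) : CycloNilHecke K ℓ n :=
  (List.ofFn fun i : Fin n => y K ℓ i ^ (ℓ - S.theta i)).prod

/-- `ψ^λ_{w,u} := ψ_w^* y_λ ψ_u`. -/
noncomputable def psiCell (S : OneBoxShape ℓ n) (w u : Equiv.Perm (Fin n)) :
    CycloNilHecke K ℓ n :=
  antiStar K ℓ (psiPerm K ℓ w) * yShape K ℓ S * psiPerm K ℓ u

/-- `F_{z₁,z₂} := (-1) ^ (n(n-1)/2) ψ^{λ_min}_{w₀ z₁, z₂}`. -/
noncomputable def matUnit (h : n ≤ ℓ) (z₁ z₂ : Equiv.Perm (Fin n)) : CycloNilHecke K ℓ n :=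
  (-1) ^ (n * (n - 1) / 2) * psiCell K ℓ (OneBoxShape.lamMin h) (longestPerm n * z₁) z₂

end CycloNilHecke

/-! Write `N = n(n-1)/2` and `Y = y_1^{n-1} ⋯ y_{n-1}` (`yTop`). Up to the sign `(-1)^N`,
`F_{z₁,z₂}` is `ψ_{(w₀z₁)⁻¹} Y ψ_{z₂}` (`matUnit_eq`), so its degree comes from `ℓ(w₀z₁) = N -
ℓ(z₁)`. The rest is decided in the case `ℓ = n`; nonvanishing for larger `ℓ` follows by projecting
to that quotient (`toTop_matUnit`).

Let `ℓ = n`. A product of two units contains the factor `Y ψ_{z₂} ψ_{(w₀u₁)⁻¹} Y`, and two facts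
evaluate it. Elements of positive degree kill `Y` from the left (`mul_yTop_eq_zero`), and `Y ψ_{w₀}
Y = (-1)^N Y` (`exists_psiWord_yTop`). A word in the `ψ_r` gives `0` when it is not reduced, and
depends only on its permutation when it is (`psiWord_eq_of_reduced`). If it is reduced but shorter
than `N`, then `Y ψ` has positive degree. Hence only reduced words of `w₀` survive, and as the
permutation here is `z₂ u₁⁻¹ w₀`, this means `z₂ = u₁`.

The first fact rests on `y_i Y = 0` (`y_mul_yTop`): the relations force the complete symmetric
polynomials `h_{n-k}(y_1, …, y_{k+1})` to vanish (`evalY_hsym`). Moving every `y` to the right of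
every `ψ` leaves at least one `y` next to `Y` in positive degree.

The units span. The two-sided ideal of `Y` contains `1` (`one_mem_span_mul_yTop_mul`), while left
and right multiples of `Y` are spanned by the `ψ_w Y` and the `Y ψ_w`. So the diagonal units sum to
`1`, and the matrix algebra, being simple, maps isomorphically onto the algebra as soon as the
latter is nonzero. That is seen from its action on the coinvariant algebra by divided differences
(`nontrivial_cycloNilHecke`). -/

/-! ### Inversions and length in the symmetric group -/

theorem simpleRefl_mul_self {n : ℕ} (r : Fin (n - 1)) : simpleRefl r * simpleRefl r = 1 :=
  Equiv.swap_mul_self _ _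

theorem simpleRefl_inv {n : ℕ} (r : Fin (n - 1)) : (simpleRefl r)⁻¹ = simpleRefl r :=
  Equiv.swap_inv _ _

theorem loIdx_lt_hiIdx {n : ℕ} (r : Fin (n - 1)) : loIdx r < hiIdx r := by
  simp [loIdx, hiIdx, Fin.lt_def]

theorem simpleRefl_loIdx {n : ℕ} (r : Fin (n - 1)) : simpleRefl r (loIdx r) = hiIdx r :=
  Equiv.swap_apply_left _ _

theorem simpleRefl_hiIdx {n : ℕ} (r : Fin (n - 1)) : simpleRefl r (hiIdx r) = loIdx r :=
  Equiv.swap_apply_right _ _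

theorem simpleRefl_of_ne {n : ℕ} (r : Fin (n - 1)) (i : Fin n) (h₁ : i ≠ loIdx r)
    (h₂ : i ≠ hiIdx r) : simpleRefl r i = i :=
  Equiv.swap_apply_of_ne_of_ne h₁ h₂

theorem mul_simpleRefl_cancel {n : ℕ} (w : Equiv.Perm (Fin n)) (r : Fin (n - 1)) :
    w * simpleRefl r * simpleRefl r = w := by
  rw [mul_assoc, simpleRefl_mul_self, mul_one]

theorem simpleRefl_lt_iff {n : ℕ} (r : Fin (n - 1)) (a b : Fin n)
    (h₁ : ¬(a = loIdx r ∧ b = hiIdx r)) (h₂ : ¬(a = hiIdx r ∧ b = loIdx r)) :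
    simpleRefl r a < simpleRefl r b ↔ a < b := by
  by_cases ha : a = loIdx r
  · subst ha
    by_cases hb : b = loIdx r
    · subst hb; simp
    have hb' : b ≠ hiIdx r := fun h => h₁ ⟨rfl, h⟩
    rw [simpleRefl_loIdx, simpleRefl_of_ne r b hb hb']
    simp only [loIdx, hiIdx, Fin.lt_def, ne_eq, Fin.ext_iff] at *
    omega
  by_cases ha' : a = hiIdx r
  · subst ha'
    by_cases hb : b = hiIdx r
    · subst hb; simp
    have hb' : b ≠ loIdx r := fun h => h₂ ⟨rfl, h⟩
    rw [simpleRefl_hiIdx, simpleRefl_of_ne r b hb' hb]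
    simp only [loIdx, hiIdx, Fin.lt_def, ne_eq, Fin.ext_iff] at *
    omega
  rw [simpleRefl_of_ne r a ha ha']
  by_cases hb : b = loIdx r
  · subst hb
    rw [simpleRefl_loIdx]
    simp only [loIdx, hiIdx, Fin.lt_def, Fin.ext_iff] at *
    omega
  by_cases hb' : b = hiIdx r
  · subst hb'
    rw [simpleRefl_hiIdx]
    simp only [loIdx, hiIdx, Fin.lt_def, Fin.ext_iff] at *
    omega
  rw [simpleRefl_of_ne r b hb hb']

/-- The inversions of a permutation. -/
def inversions {n : ℕ} (w : Equiv.Perm (Fin n)) : Finset (Fin n × Fin n) :=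
  Finset.univ.filter fun p => p.1 < p.2 ∧ w p.2 < w p.1

theorem mem_inversions {n : ℕ} (w : Equiv.Perm (Fin n)) (p : Fin n × Fin n) :
    p ∈ inversions w ↔ p.1 < p.2 ∧ w p.2 < w p.1 := by
  simp [inversions]

/-- The number of inversions of a permutation. -/
def numInv {n : ℕ} (w : Equiv.Perm (Fin n)) : ℕ := (inversions w).card

/-- Applying `s_r` to both entries preserves the order of every pair except `(r, r+1)`. It therefore
carries the inversions of `w` to those of `w s_r` other than this one new pair. -/
theorem numInv_mul_simpleRefl_of_lt {n : ℕ} (w : Equiv.Perm (Fin n)) (r : Fin (n - 1))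
    (h : w (loIdx r) < w (hiIdx r)) : numInv (w * simpleRefl r) = numInv w + 1 := by
  have key : inversions (w * simpleRefl r) = insert (loIdx r, hiIdx r)
      ((inversions w).map ((simpleRefl r).prodCongr (simpleRefl r)).toEmbedding) := by
    ext ⟨a, b⟩
    rw [Finset.mem_insert, Finset.mem_map_equiv, mem_inversions, mem_inversions]
    have hs : (simpleRefl r).symm = simpleRefl r := simpleRefl_inv r
    simp only [Equiv.prodCongr_symm, hs, Equiv.prodCongr_apply, Prod.map_apply,
      Equiv.Perm.mul_apply, Prod.mk.injEq]
    by_cases h₁ : a = loIdx r ∧ b = hiIdx r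
    · obtain ⟨rfl, rfl⟩ := h₁
      simp [simpleRefl_loIdx, simpleRefl_hiIdx, h, loIdx_lt_hiIdx]
    by_cases h₂ : a = hiIdx r ∧ b = loIdx r
    · obtain ⟨rfl, rfl⟩ := h₂
      simp [simpleRefl_loIdx, simpleRefl_hiIdx, h.le, (loIdx_lt_hiIdx r).ne']
    rw [simpleRefl_lt_iff r a b h₁ h₂]
    simp [h₁]
  rw [numInv, key, Finset.card_insert_of_notMem, Finset.card_map, numInv]
  rw [Finset.mem_map_equiv, mem_inversions]
  have hs : (simpleRefl r).symm = simpleRefl r := simpleRefl_inv r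
  simp [hs, simpleRefl_loIdx, simpleRefl_hiIdx, (loIdx_lt_hiIdx r).le]

theorem numInv_mul_simpleRefl_of_gt {n : ℕ} (w : Equiv.Perm (Fin n)) (r : Fin (n - 1))
    (h : w (hiIdx r) < w (loIdx r)) : numInv (w * simpleRefl r) + 1 = numInv w := by
  have := numInv_mul_simpleRefl_of_lt (w * simpleRefl r) r
    (by simpa [simpleRefl_loIdx, simpleRefl_hiIdx] using h)
  rw [mul_simpleRefl_cancel] at this
  exact this.symm

theorem apply_loIdx_lt_or_gt {n : ℕ} (w : Equiv.Perm (Fin n)) (r : Fin (n - 1)) :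
    w (loIdx r) < w (hiIdx r) ∨ w (hiIdx r) < w (loIdx r) :=
  lt_or_gt_of_ne fun h => (loIdx_lt_hiIdx r).ne (w.injective h)

theorem descent_of_numInv_le {n : ℕ} (w : Equiv.Perm (Fin n)) (r : Fin (n - 1))
    (h : numInv (w * simpleRefl r) ≤ numInv w) : w (hiIdx r) < w (loIdx r) := by
  rcases apply_loIdx_lt_or_gt w r with h' | h'
  · rw [numInv_mul_simpleRefl_of_lt w r h'] at h; omega
  · exact h'

theorem numInv_one {n : ℕ} : numInv (1 : Equiv.Perm (Fin n)) = 0 := by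
  rw [numInv, Finset.card_eq_zero, Finset.eq_empty_iff_forall_notMem]
  intro p hp
  rw [mem_inversions] at hp
  exact lt_asymm hp.1 hp.2

theorem numInv_mul_simpleRefl_le {n : ℕ} (w : Equiv.Perm (Fin n)) (r : Fin (n - 1)) :
    numInv (w * simpleRefl r) ≤ numInv w + 1 := by
  rcases apply_loIdx_lt_or_gt w r with h | h
  · exact (numInv_mul_simpleRefl_of_lt w r h).le
  · have := numInv_mul_simpleRefl_of_gt w r h; omega

/-- The permutation expressed by a word. -/
def wordPerm {n : ℕ} (L : List (Fin (n - 1))) : Equiv.Perm (Fin n) := (L.map simpleRefl).prod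

theorem wordPerm_append {n : ℕ} (L M : List (Fin (n - 1))) :
    wordPerm (L ++ M) = wordPerm L * wordPerm M := by
  simp [wordPerm]

theorem wordPerm_concat {n : ℕ} (L : List (Fin (n - 1))) (r : Fin (n - 1)) :
    wordPerm (L ++ [r]) = wordPerm L * simpleRefl r := by
  simp [wordPerm]

theorem wordPerm_reverse {n : ℕ} (L : List (Fin (n - 1))) :
    wordPerm L.reverse = (wordPerm L)⁻¹ := by
  induction L with
  | nil => simp [wordPerm]
  | cons r L ih =>
    rw [List.reverse_cons, wordPerm_concat, ih, ← List.singleton_append, wordPerm_append,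
      mul_inv_rev]
    simp [wordPerm, simpleRefl_inv]

theorem numInv_wordPerm_le {n : ℕ} (L : List (Fin (n - 1))) : numInv (wordPerm L) ≤ L.length := by
  induction L using List.reverseRecOn with
  | nil => simp [wordPerm, numInv_one]
  | append_singleton L r ih =>
    rw [wordPerm_concat, List.length_append, List.length_singleton]
    exact (numInv_mul_simpleRefl_le _ _).trans (by omega)

theorem exists_descent {n : ℕ} (w : Equiv.Perm (Fin n)) (hw : w ≠ 1) :
    ∃ r : Fin (n - 1), w (hiIdx r) < w (loIdx r) := by
  by_contra! hcon
  apply hw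
  rcases n with _ | m
  · exact Subsingleton.elim _ _
  have hmono : StrictMono w := by
    rw [Fin.strictMono_iff_lt_succ]
    intro i
    refine lt_of_le_of_ne (hcon i) fun h => ?_
    exact (Fin.castSucc_lt_succ (i := i)).ne (w.injective h)
  -- The identity is the only order automorphism of a finite chain.
  have := Subsingleton.elim (α := Fin (m + 1) ≃o Fin (m + 1))
    (hmono.orderIsoOfSurjective w w.surjective) (OrderIso.refl _)
  ext i
  exact congrArg Fin.val (DFunLike.congr_fun this i)

theorem exists_word {n : ℕ} (w : Equiv.Perm (Fin n)) :
    ∃ L : List (Fin (n - 1)), wordPerm L = w ∧ L.length = numInv w := by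
  induction hk : numInv w generalizing w with
  | zero =>
    refine ⟨[], ?_, rfl⟩
    by_contra hne
    obtain ⟨r, hr⟩ := exists_descent w (fun h => hne (by rw [h]; rfl))
    have := numInv_mul_simpleRefl_of_gt w r hr
    omega
  | succ k ih =>
    obtain ⟨r, hr⟩ := exists_descent w (by rintro rfl; rw [numInv_one] at hk; omega)
    have := numInv_mul_simpleRefl_of_gt w r hr
    obtain ⟨L, hL, hl⟩ := ih (w * simpleRefl r) (by omega)
    exact ⟨L ++ [r], by rw [wordPerm_concat, hL, mul_simpleRefl_cancel], by simp [hl]⟩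

/-- Each letter adds at most one inversion, which bounds the length from below; removing descents
one at a time produces a word attaining the bound. -/
theorem permLength_eq_numInv {n : ℕ} (w : Equiv.Perm (Fin n)) : permLength w = numInv w := by
  obtain ⟨L, hL, hl⟩ := exists_word w
  refine le_antisymm (Nat.sInf_le ⟨L, hL, hl⟩) ?_
  rw [← (reducedExpr_spec w).2]
  conv_lhs => rw [← (reducedExpr_spec w).1]
  exact numInv_wordPerm_le _

theorem wordPerm_reducedExpr {n : ℕ} (w : Equiv.Perm (Fin n)) : wordPerm (reducedExpr w) = w :=
  (reducedExpr_spec w).1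

theorem length_reducedExpr {n : ℕ} (w : Equiv.Perm (Fin n)) :
    (reducedExpr w).length = numInv w := by
  rw [(reducedExpr_spec w).2, permLength_eq_numInv]

theorem eq_one_of_numInv_eq_zero {n : ℕ} (w : Equiv.Perm (Fin n)) (h : numInv w = 0) : w = 1 := by
  by_contra hne
  obtain ⟨r, hr⟩ := exists_descent w hne
  have := numInv_mul_simpleRefl_of_gt w r hr
  omega

theorem card_pairs_lt (n : ℕ) :
    (Finset.univ.filter fun p : Fin n × Fin n => p.1 < p.2).card = n * (n - 1) / 2 := by
  rw [Finset.card_filter, Fintype.sum_prod_type, ← Finset.sum_range_id,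
    ← Finset.sum_range_reflect, ← Fin.sum_univ_eq_sum_range (fun i => n - 1 - i)]
  refine Finset.sum_congr rfl fun i _ => ?_
  rw [← Finset.card_filter, ← Fin.card_Ioi]
  congr 1
  ext j
  simp

/-- Reversing the values exchanges inversions and non-inversions among the pairs `i < j`. -/
theorem numInv_revPerm_mul {n : ℕ} (w : Equiv.Perm (Fin n)) :
    numInv (Fin.revPerm * w) + numInv w = n * (n - 1) / 2 := by
  rw [← card_pairs_lt, ← Finset.card_filter_add_card_filter_not
    (s := Finset.univ.filter fun p : Fin n × Fin n => p.1 < p.2) (fun p => w p.1 < w p.2),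
    numInv, numInv, inversions, inversions, Finset.filter_filter, Finset.filter_filter]
  congr 2
  · ext p; simp
  · ext p
    simp only [Finset.mem_filter, Finset.mem_univ, true_and, not_lt]
    refine and_congr_right fun h => ⟨le_of_lt, fun h' => lt_of_le_of_ne h' fun e => ?_⟩
    exact h.ne' (w.injective e)

/-- The longest element is only given as some maximiser of the length. Maximality leaves its
composite with the reversal no inversions, so that composite is trivial. -/
theorem longestPerm_eq_revPerm (n : ℕ) : longestPerm n = Fin.revPerm := by
  have h₁ := permLength_le_longestPerm (Fin.revPerm (n := n))
  rw [permLength_eq_numInv, permLength_eq_numInv] at h₁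
  have h₂ := numInv_revPerm_mul (1 : Equiv.Perm (Fin n))
  have h₃ := numInv_revPerm_mul (longestPerm n)
  rw [mul_one, numInv_one] at h₂
  have h₄ := eq_one_of_numInv_eq_zero _ (by omega : numInv (Fin.revPerm * longestPerm n) = 0)
  have h₅ : (Fin.revPerm : Equiv.Perm (Fin n))⁻¹ = Fin.revPerm := Fin.revPerm_symm
  rw [← h₅]
  exact eq_inv_of_mul_eq_one_right h₄

theorem longestPerm_mul_self (n : ℕ) : longestPerm n * longestPerm n = 1 := by
  rw [longestPerm_eq_revPerm]
  ext i
  simp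

theorem numInv_longestPerm_mul {n : ℕ} (w : Equiv.Perm (Fin n)) :
    numInv (longestPerm n * w) + numInv w = n * (n - 1) / 2 := by
  rw [longestPerm_eq_revPerm, numInv_revPerm_mul]

theorem numInv_longestPerm (n : ℕ) : numInv (longestPerm n) = n * (n - 1) / 2 := by
  simpa [numInv_one] using numInv_longestPerm_mul (1 : Equiv.Perm (Fin n))

theorem eq_longestPerm_of_numInv {n : ℕ} (w : Equiv.Perm (Fin n))
    (h : numInv w = n * (n - 1) / 2) : w = longestPerm n := by
  have h₁ := numInv_longestPerm_mul w
  have h₂ := eq_one_of_numInv_eq_zero _ (by omega : numInv (longestPerm n * w) = 0)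
  rw [eq_inv_of_mul_eq_one_right h₂]
  exact inv_eq_of_mul_eq_one_right (longestPerm_mul_self n)

theorem numInv_inv {n : ℕ} (w : Equiv.Perm (Fin n)) : numInv w⁻¹ = numInv w := by
  have h : ∀ u : Equiv.Perm (Fin n), numInv u⁻¹ ≤ numInv u := fun u => by
    obtain ⟨L, hL, hl⟩ := exists_word u
    rw [← hl, ← L.length_reverse, ← hL, ← wordPerm_reverse]
    exact numInv_wordPerm_le _
  exact le_antisymm (h w) (by simpa using h w⁻¹)

/-! ### Products of the `ψ_r` along words -/

namespace CycloNilHecke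

variable (K : Type*) [Field K] (ℓ : ℕ) {n : ℕ}

/-- The product of the `ψ_r` along a word. -/
noncomputable def psiWord (L : List (Fin (n - 1))) : CycloNilHecke K ℓ n := (L.map (psi K ℓ)).prod

theorem psiWord_nil : psiWord K ℓ ([] : List (Fin (n - 1))) = 1 := rfl

theorem psiWord_cons (r : Fin (n - 1)) (L : List (Fin (n - 1))) :
    psiWord K ℓ (r :: L) = psi K ℓ r * psiWord K ℓ L := by
  simp [psiWord]

theorem psiWord_append (L M : List (Fin (n - 1))) :
    psiWord K ℓ (L ++ M) = psiWord K ℓ L * psiWord K ℓ M := by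
  simp [psiWord]

theorem psiWord_singleton (r : Fin (n - 1)) : psiWord K ℓ [r] = psi K ℓ r := by
  simp [psiWord]

theorem simpleRefl_comm (i j : Fin (n - 1)) (h : i.1 + 1 < j.1) :
    simpleRefl i * simpleRefl j = simpleRefl j * simpleRefl i := by
  refine Equiv.Perm.Disjoint.commute fun x => ?_
  by_cases h₁ : x = loIdx i
  · right; subst h₁; apply simpleRefl_of_ne <;> simp [loIdx, hiIdx, Fin.ext_iff] <;> omega
  by_cases h₂ : x = hiIdx i
  · right; subst h₂; apply simpleRefl_of_ne <;> simp [loIdx, hiIdx, Fin.ext_iff] <;> omega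
  exact Or.inl (simpleRefl_of_ne _ _ h₁ h₂)

theorem simpleRefl_braid (i j : Fin (n - 1)) (h : j.1 = i.1 + 1) :
    simpleRefl i * simpleRefl j * simpleRefl i = simpleRefl j * simpleRefl i * simpleRefl j := by
  have hm : loIdx j = hiIdx i := by simp [loIdx, hiIdx, h]
  have h₁ : loIdx i ≠ hiIdx i := (loIdx_lt_hiIdx i).ne
  have h₂ : hiIdx i ≠ hiIdx j := by rw [← hm]; exact (loIdx_lt_hiIdx j).ne
  have h₃ : loIdx i ≠ hiIdx j := by simp [loIdx, hiIdx, h, Fin.ext_iff]; omega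
  ext x
  simp only [simpleRefl, hm, Equiv.Perm.mul_apply, Equiv.swap_apply_def]
  grind

/-- Two reduced words of the same permutation give the same product of the `ψ_r`. -/
theorem psiWord_eq_of_reduced (L M : List (Fin (n - 1))) (hLM : wordPerm L = wordPerm M)
    (hL : L.length = numInv (wordPerm L)) (hM : M.length = numInv (wordPerm L)) :
    psiWord K ℓ L = psiWord K ℓ M := by
  induction hk : L.length generalizing L M with
  | zero =>
    rw [List.length_eq_zero_iff.1 hk, List.length_eq_zero_iff.1 (by omega : M.length = 0)]
  | succ k ih =>
    obtain ⟨L, i, rfl⟩ : ∃ L' i, L = L' ++ [i] := by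
      rcases L.eq_nil_or_concat with rfl | ⟨L', i, rfl⟩
      · simp at hk
      · exact ⟨L', i, by simp⟩
    obtain ⟨M, j, rfl⟩ : ∃ L' i, M = L' ++ [i] := by
      rcases M.eq_nil_or_concat with rfl | ⟨L', i, rfl⟩
      · simp at hM; omega
      · exact ⟨L', i, by simp⟩
    have hMk : (M ++ [j]).length = k + 1 := by omega
    rw [hk] at hL
    clear hM
    -- Both last letters `i` and `j` are descents of `w`; the cases are `i = j`, commuting letters
    -- and adjacent letters.
    wlog hij : i.1 ≤ j.1 generalizing i j L M
    · exact (this M j (by rw [← hLM]; exact hL) hMk L i hLM.symm hk (by omega)).symm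
    simp only [List.length_append, List.length_singleton, Nat.add_right_cancel_iff] at hk hMk
    set w := wordPerm (L ++ [i]) with hw
    have hLw : wordPerm L = w * simpleRefl i := by
      rw [hw, wordPerm_concat, mul_simpleRefl_cancel]
    have hMw : wordPerm M = w * simpleRefl j := by
      rw [hLM, wordPerm_concat, mul_simpleRefl_cancel]
    have hi : w (hiIdx i) < w (loIdx i) := descent_of_numInv_le _ _ (by
      rw [← hLw]; exact (numInv_wordPerm_le L).trans (by omega))
    have hj : w (hiIdx j) < w (loIdx j) := descent_of_numInv_le _ _ (by
      rw [← hMw]; exact (numInv_wordPerm_le M).trans (by omega))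
    have ei := numInv_mul_simpleRefl_of_gt w i hi
    have ej := numInv_mul_simpleRefl_of_gt w j hj
    have key : ∀ N : List (Fin (n - 1)), ∀ V : List (Fin (n - 1)), N.length = k → V.length = k →
        numInv (wordPerm N) = k → wordPerm V = wordPerm N → psiWord K ℓ N = psiWord K ℓ V :=
      fun N V h₁ h₂ h₃ h₄ => ih N V h₄.symm (by omega) (by omega) h₁
    rw [psiWord_append, psiWord_append, psiWord_singleton, psiWord_singleton]
    have hLk : numInv (wordPerm L) = k := by rw [hLw]; omega
    have hMk' : numInv (wordPerm M) = k := by rw [hMw]; omega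
    rcases hij.eq_or_lt with hij | hij
    · obtain rfl : i = j := Fin.ext hij
      rw [key L M hk hMk hLk (by rw [hLw, hMw])]
    -- Commuting letters: with `V` a reduced word of `w s_i s_j`, the induction hypothesis replaces
    -- the two words by `V j i` and `V i j`.
    rcases Nat.lt_or_ge (i.1 + 1) j.1 with hij' | hij'
    · have hv := numInv_mul_simpleRefl_of_gt (w * simpleRefl i) j (by
        rw [Equiv.Perm.mul_apply, Equiv.Perm.mul_apply, simpleRefl_of_ne, simpleRefl_of_ne]
        · exact hj
        all_goals simp [loIdx, hiIdx, Fin.ext_iff]; omega)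
      obtain ⟨V, hV, hVl⟩ := exists_word (w * simpleRefl i * simpleRefl j)
      rw [key L (V ++ [j]) hk (by simp; omega) hLk
          (by rw [wordPerm_concat, hV, hLw, mul_simpleRefl_cancel]),
        key M (V ++ [i]) hMk (by simp; omega) hMk'
          (by rw [wordPerm_concat, hV, hMw, mul_assoc w, simpleRefl_comm i j hij', ← mul_assoc,
            mul_simpleRefl_cancel]),
        psiWord_append, psiWord_append, psiWord_singleton, psiWord_singleton, mul_assoc,
        mul_assoc, psi_comm K ℓ j i hij']
    -- Adjacent letters: `w` reverses three consecutive positions, so `w s_i s_j s_i` is shorter by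
    -- three. With `V` a reduced word of it, the two words become `V i j i` and `V j i j`, which the
    -- braid relation identifies.
    · have hji : j.1 = i.1 + 1 := by omega
      have hm : loIdx j = hiIdx i := by simp [loIdx, hiIdx, hji]
      have h₁ : loIdx i ≠ hiIdx i := (loIdx_lt_hiIdx i).ne
      have h₂ : hiIdx j ≠ hiIdx i := by rw [← hm]; exact (loIdx_lt_hiIdx j).ne'
      have h₃ : hiIdx j ≠ loIdx i := by simp [loIdx, hiIdx, hji, Fin.ext_iff]; omega
      have s₁ : simpleRefl i (hiIdx j) = hiIdx j := simpleRefl_of_ne _ _ h₃ h₂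
      have s₂ : simpleRefl j (loIdx i) = loIdx i := simpleRefl_of_ne _ _ (hm ▸ h₁) h₃.symm
      have s₃ : simpleRefl j (hiIdx i) = hiIdx j := by rw [← hm, simpleRefl_loIdx]
      rw [hm] at hj
      have hv₁ := numInv_mul_simpleRefl_of_gt (w * simpleRefl i) j (by
        rw [Equiv.Perm.mul_apply, Equiv.Perm.mul_apply, hm, s₁, simpleRefl_hiIdx]
        exact hj.trans hi)
      have hv₂ := numInv_mul_simpleRefl_of_gt (w * simpleRefl i * simpleRefl j) i (by
        simp only [Equiv.Perm.mul_apply, s₁, s₂, s₃, simpleRefl_loIdx]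
        exact hj)
      obtain ⟨V, hV, hVl⟩ := exists_word (w * simpleRefl i * simpleRefl j * simpleRefl i)
      have hV' : wordPerm V = w * simpleRefl j * simpleRefl i * simpleRefl j := by
        rw [hV, mul_assoc w, mul_assoc w, simpleRefl_braid i j hji, mul_assoc w, mul_assoc w,
          mul_assoc]
      have hs : ∀ a b : Fin (n - 1), V ++ [a, b] = (V ++ [a]) ++ [b] := by simp
      rw [key L (V ++ [i, j]) hk (by simp; omega) hLk (by
          rw [hs, wordPerm_concat, wordPerm_concat, hV, hLw, mul_simpleRefl_cancel,
            mul_simpleRefl_cancel]),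
        key M (V ++ [j, i]) hMk (by simp; omega) hMk' (by
          rw [hs, wordPerm_concat, wordPerm_concat, hV', hMw, mul_simpleRefl_cancel,
            mul_simpleRefl_cancel])]
      simp only [psiWord_append, psiWord_cons, psiWord_nil, mul_one, mul_assoc]
      rw [← mul_assoc (psi K ℓ i), braid K ℓ i j hji, mul_assoc]

/-- Where a reduced prefix first ceases to be reduced, the next letter `r` is a descent of the
prefix. The prefix can then be rewritten to end in `r`, and `ψ_r² = 0` applies. -/
theorem psiWord_eq_zero_of_not_reduced (L : List (Fin (n - 1)))
    (hL : numInv (wordPerm L) < L.length) : psiWord K ℓ L = 0 := by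
  induction L using List.reverseRecOn with
  | nil => simp at hL
  | append_singleton L r ih =>
    rw [psiWord_append, psiWord_singleton]
    rcases (numInv_wordPerm_le L).lt_or_eq with h | h
    · rw [ih h, zero_mul]
    rw [wordPerm_concat, List.length_append, List.length_singleton, ← h] at hL
    have hd := numInv_mul_simpleRefl_of_gt _ r
      (descent_of_numInv_le (wordPerm L) r (by omega))
    obtain ⟨V, hV, hVl⟩ := exists_word (wordPerm L * simpleRefl r)
    rw [psiWord_eq_of_reduced K ℓ L (V ++ [r])
      (by rw [wordPerm_concat, hV, mul_simpleRefl_cancel]) h.symm (by simp; omega),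
      psiWord_append, psiWord_singleton, mul_assoc, psi_sq, mul_zero]

theorem psiPerm_eq_psiWord (L : List (Fin (n - 1))) (hL : L.length = numInv (wordPerm L)) :
    psiPerm K ℓ (wordPerm L) = psiWord K ℓ L :=
  psiWord_eq_of_reduced K ℓ _ _ (wordPerm_reducedExpr _)
    (by rw [wordPerm_reducedExpr, length_reducedExpr]) (by rw [wordPerm_reducedExpr, hL])

theorem psiWord_eq_psiPerm_or_zero (L : List (Fin (n - 1))) :
    psiWord K ℓ L = psiPerm K ℓ (wordPerm L) ∨ psiWord K ℓ L = 0 := by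
  rcases (numInv_wordPerm_le L).lt_or_eq with h | h
  · exact Or.inr (psiWord_eq_zero_of_not_reduced K ℓ L h)
  · exact Or.inl (psiPerm_eq_psiWord K ℓ L h.symm).symm

theorem antiStar_psiWord (L : List (Fin (n - 1))) :
    antiStar K ℓ (psiWord K ℓ L) = psiWord K ℓ L.reverse := by
  induction L with
  | nil => simp [psiWord, antiStar]
  | cons r L ih =>
    rw [psiWord_cons, antiStar_mul, ih, List.reverse_cons, psiWord_append, psiWord_singleton, psi,
      antiStar_gen]

theorem antiStar_psiPerm (w : Equiv.Perm (Fin n)) :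
    antiStar K ℓ (psiPerm K ℓ w) = psiPerm K ℓ w⁻¹ := by
  have h : wordPerm (reducedExpr w).reverse = w⁻¹ := by
    rw [wordPerm_reverse, wordPerm_reducedExpr]
  rw [← h, psiPerm_eq_psiWord]
  · exact antiStar_psiWord K ℓ _
  · rw [h, List.length_reverse, length_reducedExpr, numInv_inv]

end CycloNilHecke

/-! ### Complete homogeneous symmetric polynomials -/

/-- The complete homogeneous symmetric polynomial of degree `m` in `x 0, …, x (k - 1)`. -/
def hsym {R : Type*} [CommRing R] (x : ℕ → R) : ℕ → ℕ → R
  | 0, _ => 1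
  | _ + 1, 0 => 0
  | m + 1, k + 1 => hsym x (m + 1) k + x k * hsym x m (k + 1)

section Hsym

variable {R : Type*} [CommRing R] (x : ℕ → R)

theorem hsym_zero (k : ℕ) : hsym x 0 k = 1 := by rw [hsym]

theorem hsym_succ_zero (m : ℕ) : hsym x (m + 1) 0 = 0 := by rw [hsym]

theorem hsym_succ_succ (m k : ℕ) :
    hsym x (m + 1) (k + 1) = hsym x (m + 1) k + x k * hsym x m (k + 1) := by rw [hsym]

theorem hsym_one (m : ℕ) : hsym x m 1 = x 0 ^ m := by
  induction m with
  | zero => simp [hsym_zero]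
  | succ m ih => rw [hsym_succ_succ, ih, hsym_succ_zero]; ring

theorem hsym_mem {S : Type*} [SetLike S R] [SubringClass S R] (s : S) (k : ℕ)
    (h : ∀ i < k, x i ∈ s) (m : ℕ) : hsym x m k ∈ s := by
  induction k generalizing m with
  | zero =>
    cases m with
    | zero => rw [hsym_zero]; exact one_mem s
    | succ m => rw [hsym_succ_zero]; exact zero_mem s
  | succ k ihk =>
    induction m with
    | zero => rw [hsym_zero]; exact one_mem s
    | succ m ih =>
      rw [hsym_succ_succ]
      exact add_mem (ihk (fun i hi => h i (by omega)) _) (mul_mem (h k (by omega)) ih)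

/-- `hsym x m (k + 2)` is symmetric in the last two variables. -/
theorem hsym_add_two_mem {S : Type*} [SetLike S R] [SubringClass S R] (s : S) (k : ℕ)
    (h : ∀ i < k, x i ∈ s) (hadd : x k + x (k + 1) ∈ s) (hmul : x k * x (k + 1) ∈ s) (m : ℕ) :
    hsym x m (k + 2) ∈ s := by
  induction m using Nat.strong_induction_on with
  | _ m ih =>
    match m, ih with
    | 0, _ => rw [hsym_zero]; exact one_mem s
    | 1, _ =>
      have e : hsym x 1 (k + 2) = hsym x 1 k + (x k + x (k + 1)) := by
        simp only [hsym_succ_succ, hsym_zero]; ring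
      rw [e]
      exact add_mem (hsym_mem x s k h 1) hadd
    | m + 2, ih =>
      -- The recurrence attached to the factor `1 / ((1 - x_k t)(1 - x_{k+1} t))` of the generating
      -- series; it involves the last two variables only through their sum and product.
      have e : hsym x (m + 2) (k + 2) = hsym x (m + 2) k + (x k + x (k + 1)) *
          hsym x (m + 1) (k + 2) - x k * x (k + 1) * hsym x m (k + 2) := by
        rw [hsym_succ_succ x (m + 1) (k + 1), hsym_succ_succ x (m + 1) k,
          hsym_succ_succ x m (k + 1)]
        ring
      rw [e]
      exact sub_mem (add_mem (hsym_mem x s k h _) (mul_mem hadd (ih (m + 1) (by omega))))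
        (mul_mem hmul (ih m (by omega)))

variable (I : Ideal R) (Q : R)

theorem mul_hsym_succ_mem (k : ℕ) (h : ∀ i < k, Q * x i ∈ I) (m : ℕ) :
    Q * hsym x (m + 1) k ∈ I := by
  induction k generalizing m with
  | zero => rw [hsym_succ_zero, mul_zero]; exact I.zero_mem
  | succ k ih =>
    rw [hsym_succ_succ, mul_add, ← mul_assoc]
    exact I.add_mem (ih (fun i hi => h i (by omega)) m) (I.mul_mem_right _ (h k (by omega)))

theorem mul_hsym_sub_pow_mem (k : ℕ) (h : ∀ i < k, Q * x i ∈ I) (m : ℕ) :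
    Q * hsym x m (k + 1) - Q * x k ^ m ∈ I := by
  induction m with
  | zero => simp [hsym_zero]
  | succ m ih =>
    have e : Q * hsym x (m + 1) (k + 1) - Q * x k ^ (m + 1) =
        Q * hsym x (m + 1) k + x k * (Q * hsym x m (k + 1) - Q * x k ^ m) := by
      rw [hsym_succ_succ]; ring
    rw [e]
    exact I.add_mem (mul_hsym_succ_mem x I Q k h m) (I.mul_mem_left _ ih)

/-- If the ideal `I` contains the complete symmetric polynomials of degree `n - k` in `k + 1`
variables, then `x_0 ^ (n-1) x_1 ^ (n-2) ⋯` is annihilated by all variables modulo `I`. -/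
theorem prod_pow_mul_mem (n : ℕ) (hI : ∀ k < n, hsym x (n - k) (k + 1) ∈ I) (k : ℕ) (hk : k ≤ n)
    (i : ℕ) (hi : i < k) : (∏ j ∈ Finset.range k, x j ^ (n - 1 - j)) * x i ∈ I := by
  induction k generalizing i with
  | zero => omega
  | succ k ih =>
    rw [Finset.prod_range_succ]
    rcases Nat.lt_or_ge i k with hik | hik
    · rw [mul_right_comm]
      exact I.mul_mem_right _ (ih (by omega) i hik)
    · obtain rfl : i = k := by omega
      -- Modulo `I` the earlier product kills `x_0, …, x_{i-1}`, so multiplying it by `h_{n-i}(x_0,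
      -- …, x_i)` leaves only the term `x_i ^ (n-i)`.
      have h := mul_hsym_sub_pow_mem x I _ i (fun j hj => ih (by omega) j hj) (n - i)
      rw [mul_assoc, ← pow_succ, show n - 1 - i + 1 = n - i by omega]
      exact (I.sub_mem_iff_right (I.mul_mem_left _ (hI i (by omega)))).1 h

end Hsym

namespace CycloNilHecke

variable (K : Type*) [Field K] (ℓ : ℕ) {n : ℕ}

/-! ### Polynomials in the `y_i` -/

section PolyY

open scoped IsMulCommutative

/-- Evaluation of polynomials at `y_1, …, y_n`. -/
noncomputable def evalY : MvPolynomial (Fin n) K →ₐ[K] CycloNilHecke K ℓ n :=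
  -- Polynomial evaluation needs a commutative target, so it is made into the subalgebra generated
  -- by the `y_i`.
  haveI : IsMulCommutative (Algebra.adjoin K (Set.range (y K ℓ (n := n)))) :=
    Algebra.isMulCommutative_adjoin K (by rintro _ ⟨i, rfl⟩ _ ⟨j, rfl⟩; exact y_comm K ℓ i j)
  (Algebra.adjoin K (Set.range (y K ℓ (n := n)))).val.comp
    (MvPolynomial.aeval fun i => ⟨y K ℓ i, Algebra.subset_adjoin ⟨i, rfl⟩⟩)

end PolyY

theorem evalY_X (i : Fin n) : evalY K ℓ (MvPolynomial.X i) = y K ℓ i := by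
  simp [evalY]

theorem evalY_mul_comm (p q : MvPolynomial (Fin n) K) :
    evalY K ℓ p * evalY K ℓ q = evalY K ℓ q * evalY K ℓ p := by
  rw [← map_mul, mul_comm, map_mul]

/-- The polynomials whose values commute with `ψ_r`. -/
noncomputable def commSubalgebra (r : Fin (n - 1)) : Subalgebra K (MvPolynomial (Fin n) K) :=
  (Subalgebra.centralizer K {psi K ℓ r}).comap (evalY K ℓ)

theorem mem_commSubalgebra (r : Fin (n - 1)) (p : MvPolynomial (Fin n) K) :
    p ∈ commSubalgebra K ℓ r ↔ psi K ℓ r * evalY K ℓ p = evalY K ℓ p * psi K ℓ r := by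
  simp [commSubalgebra, Subalgebra.mem_centralizer_iff]

theorem X_mem_commSubalgebra (r : Fin (n - 1)) (i : Fin n) (h₁ : i ≠ loIdx r)
    (h₂ : i ≠ hiIdx r) : MvPolynomial.X i ∈ commSubalgebra K ℓ r := by
  rw [mem_commSubalgebra, evalY_X, psi_y_far K ℓ r i h₁ h₂]

theorem add_mem_commSubalgebra (r : Fin (n - 1)) :
    MvPolynomial.X (loIdx r) + MvPolynomial.X (hiIdx r) ∈ commSubalgebra K ℓ r := by
  rw [mem_commSubalgebra, map_add, evalY_X, evalY_X, mul_add, add_mul, psi_y, y_psi]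
  abel

theorem mul_mem_commSubalgebra (r : Fin (n - 1)) :
    MvPolynomial.X (loIdx r) * MvPolynomial.X (hiIdx r) ∈ commSubalgebra K ℓ r := by
  rw [mem_commSubalgebra, map_mul, evalY_X, evalY_X, mul_assoc, y_psi, y_comm, ← mul_assoc, psi_y,
    add_mul, mul_add, one_mul, mul_one, mul_assoc]

/-- The variable `X_i`, extended by `0`. -/
noncomputable def varX (n : ℕ) (i : ℕ) : MvPolynomial (Fin n) K :=
  if h : i < n then MvPolynomial.X ⟨i, h⟩ else 0

theorem varX_val (i : Fin n) : varX K n i = MvPolynomial.X i := by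
  simp [varX]

/-- The case `k = 0` is the cyclotomic relation. For the step, let `G` be the next polynomial,
symmetric in `y_r` and `y_{r+1}`. By induction `y_{r+1} G` equals a polynomial with the same
symmetry, so both commute with `ψ_r`. Since `ψ_r = ψ_r y_{r+1} ψ_r`, this gives `ψ_r G = y_{r+1} G
ψ_r² = 0`, and then `G = (y_{r+1} ψ_r - ψ_r y_r) G = 0`. -/
theorem evalY_hsym (k : ℕ) (hk : k < n) : evalY K n (hsym (varX K n) (n - k) (k + 1)) = 0 := by
  induction k with
  | zero =>
    rw [hsym_one, map_pow, varX, dif_pos hk, evalY_X, Nat.sub_zero]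
    exact cyclotomic K n _ rfl
  | succ k ih =>
    obtain ⟨m, hm⟩ : ∃ m, n - (k + 1) = m := ⟨_, rfl⟩
    have hf := ih (by omega)
    rw [show n - k = m + 1 by omega] at hf
    rw [hm]
    let r : Fin (n - 1) := ⟨k, by omega⟩
    have hlo : varX K n k = MvPolynomial.X (loIdx r) := varX_val K (loIdx r)
    have hhi : varX K n (k + 1) = MvPolynomial.X (hiIdx r) := varX_val K (hiIdx r)
    have hmem : ∀ j, hsym (varX K n) j (k + 2) ∈ commSubalgebra K n r := by
      refine fun j => hsym_add_two_mem _ _ _ (fun i hi => ?_) ?_ ?_ j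
      · rw [varX, dif_pos (by omega)]
        apply X_mem_commSubalgebra <;> simp [loIdx, hiIdx, Fin.ext_iff, r] <;> omega
      · rw [hlo, hhi]; exact add_mem_commSubalgebra K n r
      · rw [hlo, hhi]; exact mul_mem_commSubalgebra K n r
    have hG := (mem_commSubalgebra K n r _).1 (hmem m)
    have hH := (mem_commSubalgebra K n r _).1 (hmem (m + 1))
    have hlG := evalY_mul_comm K n (varX K n k) (hsym (varX K n) m (k + 2))
    rw [hsym_succ_succ, map_add, hf, zero_add, map_mul, hhi, evalY_X] at hH
    rw [hlo, evalY_X] at hlG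
    change evalY K n (hsym (varX K n) m (k + 2)) = 0
    set G := evalY K n (hsym (varX K n) m (k + 2))
    have h₁ : psi K n r * y K n (hiIdx r) * psi K n r = psi K n r := by
      rw [psi_y, add_mul, mul_assoc, psi_sq, mul_zero, zero_add, one_mul]
    have h₂ : psi K n r * G = 0 := by
      rw [← h₁, mul_assoc, hG, mul_assoc, ← mul_assoc (y K n _), ← mul_assoc, hH, mul_assoc,
        psi_sq, mul_zero]
    have h₃ : y K n (hiIdx r) * psi K n r * G = G := by
      rw [y_psi, add_mul, mul_assoc, hlG, ← mul_assoc, h₂, zero_mul, zero_add, one_mul]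
    rw [← h₃, mul_assoc, h₂, mul_zero]

/-- The value at `y_1, …, y_n` of the monomial with the given exponents. -/
noncomputable def yMon (n : ℕ) (a : ℕ → ℕ) : CycloNilHecke K ℓ n :=
  evalY K ℓ (∏ i : Fin n, MvPolynomial.X i ^ a i)

/-- The element `y_1 ^ (n-1) y_2 ^ (n-2) ⋯ y_{n-1}`. -/
noncomputable def yTop (n : ℕ) : CycloNilHecke K ℓ n := yMon K ℓ n fun i => n - 1 - i

theorem y_mul_yTop (i : Fin n) : y K n i * yTop K n n = 0 := by
  have h := prod_pow_mul_mem (varX K n) (RingHom.ker (evalY K n)) n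
    (fun k hk => (RingHom.mem_ker).2 (evalY_hsym K k hk)) n le_rfl i i.2
  rw [RingHom.mem_ker, Finset.prod_range, mul_comm, map_mul, varX_val, evalY_X] at h
  rw [yTop, yMon]
  simpa only [varX_val] using h

theorem yMon_mem_gradedPart (a : ℕ → ℕ) :
    yMon K ℓ n a ∈ gradedPart K ℓ n (2 * ∑ i : Fin n, (a i : ℤ)) := by
  rw [yMon]
  induction (Finset.univ : Finset (Fin n)) using Finset.induction_on with
  | empty => simpa using SetLike.GradedOne.one_mem
  | insert i s hi ih =>
    rw [Finset.prod_insert hi, Finset.sum_insert hi, map_mul, map_pow, evalY_X, mul_add]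
    refine SetLike.GradedMul.mul_mem ?_ ih
    have := SetLike.pow_mem_graded (a i) (gen_mem K ℓ (.y i))
    rwa [genDeg, nsmul_eq_mul, mul_comm] at this

theorem sum_staircase (n : ℕ) : ∑ i : Fin n, (n - 1 - i.1) = n * (n - 1) / 2 := by
  rw [Fin.sum_univ_eq_sum_range (fun i => n - 1 - i), Finset.sum_range_reflect (fun i => i),
    Finset.sum_range_id]

theorem yTop_mem_gradedPart : yTop K ℓ n ∈ gradedPart K ℓ n (2 * (n * (n - 1) / 2 : ℕ)) := by
  have h := yMon_mem_gradedPart K ℓ (n := n) fun i => n - 1 - i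
  rwa [← Nat.cast_sum, sum_staircase] at h

theorem psiWord_mem_gradedPart (L : List (Fin (n - 1))) :
    psiWord K ℓ L ∈ gradedPart K ℓ n (-2 * L.length) :=
  Submodule.subset_span ⟨L.map .psi, by simp [Function.comp_def, genDeg, mul_comm], by
    rw [List.map_map]; rfl⟩

/-- With equal exponents the monomial involves `y_r` and `y_{r+1}` only through their product, which
commutes with `ψ_r`. -/
theorem yMon_psi_comm (a : ℕ → ℕ) (r : Fin (n - 1)) (h : a r = a (r + 1)) :
    psi K ℓ r * yMon K ℓ n a = yMon K ℓ n a * psi K ℓ r := by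
  refine (mem_commSubalgebra K ℓ r _).1 ?_
  have hne : hiIdx r ∈ Finset.univ.erase (loIdx r) := by simp [(loIdx_lt_hiIdx r).ne']
  rw [← Finset.mul_prod_erase _ _ (Finset.mem_univ (loIdx r)), ← Finset.mul_prod_erase _ _ hne,
    ← mul_assoc, show a (hiIdx r) = a (loIdx r) from h.symm, ← mul_pow]
  refine mul_mem (pow_mem (mul_mem_commSubalgebra K ℓ r) _) (prod_mem fun i hi => ?_)
  simp only [Finset.mem_erase, Finset.mem_univ, and_true] at hi
  exact pow_mem (X_mem_commSubalgebra K ℓ r i hi.2 hi.1) _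

theorem yMon_update (a : ℕ → ℕ) (i : Fin n) :
    yMon K ℓ n (Function.update a i (a i + 1)) = y K ℓ i * yMon K ℓ n a := by
  have h : (∏ j : Fin n, MvPolynomial.X j ^ Function.update a i (a i + 1) j :
      MvPolynomial (Fin n) K) = MvPolynomial.X i * ∏ j : Fin n, MvPolynomial.X j ^ a j := by
    rw [← Finset.mul_prod_erase _ _ (Finset.mem_univ i),
      ← Finset.mul_prod_erase _ (fun j : Fin n => (MvPolynomial.X j : MvPolynomial (Fin n) K) ^ a j)
        (Finset.mem_univ i), Function.update_self, pow_succ', mul_assoc]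
    congr 2
    refine Finset.prod_congr rfl fun j hj => ?_
    rw [Function.update_of_ne]
    exact fun h => Finset.ne_of_mem_erase hj (Fin.ext h)
  rw [yMon, h, map_mul, evalY_X, yMon]

/-- Induction on the exponents of the monomials between `1` and `y_1 ^ (n-1) ⋯ y_{n-1}`. -/
theorem staircase_induction (n : ℕ) {P : (ℕ → ℕ) → Prop} (h0 : P fun _ => 0)
    (hs : ∀ a r, r + 1 < n → a r = a (r + 1) → P a → P (Function.update a r (a r + 1)))
    (a : ℕ → ℕ) (h₁ : ∀ i, a (i + 1) ≤ a i) (h₂ : ∀ i, a i ≤ a (i + 1) + 1)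
    (h₃ : ∀ i, n ≤ i + 1 → a i = 0) : P a := by
  induction hk : ∑ i ∈ Finset.range n, a i using Nat.strong_induction_on generalizing a with
  | _ k ih =>
    by_cases hex : ∃ r, a r ≠ a (r + 1)
    · classical
      obtain ⟨r, hr, hmin⟩ : ∃ r, a r ≠ a (r + 1) ∧ ∀ i < r, a i = a (i + 1) :=
        ⟨Nat.find hex, Nat.find_spec hex, fun i hi => not_not.1 (Nat.find_min hex hi)⟩
      have ha : a r = a (r + 1) + 1 := by have := h₁ r; have := h₂ r; omega
      have hrn : r + 1 < n := by
        by_contra hcon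
        have := h₃ r (by omega)
        omega
      -- Lowering `a` at its first drop keeps all drops at most one: the entries before `r` are
      -- equal to `a r`, so a drop of one merely moves to `r - 1`.
      set b := Function.update a r (a (r + 1)) with hb
      have hbr : b r = a (r + 1) := Function.update_self ..
      have hbn : ∀ i, i ≠ r → b i = a i := fun i hi => Function.update_of_ne hi ..
      have hab : a = Function.update b r (b r + 1) := by
        rw [hbr, ← ha, hb, Function.update_idem, Function.update_eq_self]
      have hsum : ∑ i ∈ Finset.range n, b i < k := by
        rw [← hk]
        refine Finset.sum_lt_sum (fun i _ => ?_) ⟨r, Finset.mem_range.2 (by omega), by omega⟩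
        by_cases hi : i = r
        · subst hi; omega
        · exact (hbn i hi).le
      rw [hab]
      refine hs b r hrn (by rw [hbr, hbn _ (by omega)]) (ih _ hsum b ?_ ?_ ?_ rfl)
      · intro i
        by_cases hi : i = r
        · subst hi; rw [hbr, hbn _ (by omega)]
        by_cases hi' : i + 1 = r
        · subst hi'
          have := h₁ i
          rw [hbr, hbn _ hi]
          omega
        · rw [hbn _ hi, hbn _ hi']; exact h₁ i
      · intro i
        by_cases hi : i = r
        · subst hi; rw [hbr, hbn _ (by omega)]; omega
        by_cases hi' : i + 1 = r
        · subst hi'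
          have := hmin i (by omega)
          rw [hbr, hbn _ hi]
          omega
        · rw [hbn _ hi, hbn _ hi']; exact h₂ i
      · intro i hi
        rw [hbn _ (by omega)]; exact h₃ i hi
    · push Not at hex
      have : a = fun _ => 0 := by
        funext i
        have hc : ∀ j, a (i + j) = a i := fun j => by
          induction j with
          | zero => rfl
          | succ j ihj => rw [← ihj, ← add_assoc]; exact (hex _).symm
        rw [← hc n]
        exact h₃ _ (by omega)
      rw [this]
      exact h0

theorem staircase_induction_top (n : ℕ) {P : (ℕ → ℕ) → Prop} (h0 : P fun _ => 0)
    (hs : ∀ a r, r + 1 < n → a r = a (r + 1) → P a → P (Function.update a r (a r + 1))) :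
    P fun i => n - 1 - i :=
  staircase_induction n h0 hs _ (fun i => by omega) (fun i => by omega) (fun i hi => by omega)

/-! ### Straightening -/

/-- The product of the `y_i` along a word. -/
noncomputable def yWord (M : List (Fin n)) : CycloNilHecke K ℓ n := (M.map (y K ℓ)).prod

/-- The span of the `ψ_L y_M` of degree `e`. -/
noncomputable def straightPart (n : ℕ) (e : ℤ) : Submodule K (CycloNilHecke K ℓ n) :=
  Submodule.span K {x | ∃ (L : List (Fin (n - 1))) (M : List (Fin n)),
    2 * (M.length : ℤ) - 2 * L.length = e ∧ psiWord K ℓ L * yWord K ℓ M = x}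

theorem psi_mul_mem_straightPart (r : Fin (n - 1)) {e : ℤ} {x : CycloNilHecke K ℓ n}
    (hx : x ∈ straightPart K ℓ n e) : psi K ℓ r * x ∈ straightPart K ℓ n (e - 2) := by
  refine (Submodule.span_le.2 ?_ : straightPart K ℓ n e ≤
    (straightPart K ℓ n (e - 2)).comap (LinearMap.mulLeft K (psi K ℓ r))) hx
  rintro _ ⟨L, M, rfl, rfl⟩
  refine Submodule.subset_span ⟨r :: L, M, ?_, ?_⟩
  · push_cast [List.length_cons]; ring
  · rw [psiWord_cons, mul_assoc]; rfl

/-- Moving a `y` to the right past `ψ_r` costs at most a term `±1`, which loses one `y` and one `ψ`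
and so keeps the degree. -/
theorem y_mul_mem_straightPart (i : Fin n) {e : ℤ} {x : CycloNilHecke K ℓ n}
    (hx : x ∈ straightPart K ℓ n e) : y K ℓ i * x ∈ straightPart K ℓ n (e + 2) := by
  refine (Submodule.span_le.2 ?_ : straightPart K ℓ n e ≤
    (straightPart K ℓ n (e + 2)).comap (LinearMap.mulLeft K (y K ℓ i))) hx
  rintro _ ⟨L, M, rfl, rfl⟩
  clear hx
  change y K ℓ i * (psiWord K ℓ L * yWord K ℓ M) ∈ straightPart K ℓ n _
  induction L generalizing i with
  | nil =>
    refine Submodule.subset_span ⟨[], i :: M, ?_, ?_⟩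
    · push_cast [List.length_cons]; ring
    · simp [psiWord, yWord]
  | cons r L ih =>
    rw [psiWord_cons, mul_assoc, ← mul_assoc]
    have hd : 2 * (M.length : ℤ) - 2 * (r :: L).length + 2 =
        2 * (M.length : ℤ) - 2 * L.length + 2 - 2 := by
      push_cast [List.length_cons]; ring
    have hx : psiWord K ℓ L * yWord K ℓ M ∈
        straightPart K ℓ n (2 * (M.length : ℤ) - 2 * L.length + 2 - 2) :=
      Submodule.subset_span ⟨L, M, by ring, rfl⟩
    have hψ := fun j : Fin n => psi_mul_mem_straightPart K ℓ r (ih j)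
    rw [hd]
    by_cases h₁ : i = loIdx r
    · subst h₁
      rw [← sub_eq_of_eq_add (psi_y K ℓ r), sub_mul, one_mul, mul_assoc]
      exact sub_mem (hψ _) hx
    by_cases h₂ : i = hiIdx r
    · subst h₂
      rw [y_psi, add_mul, one_mul, mul_assoc]
      exact add_mem (hψ _) hx
    · rw [← psi_y_far K ℓ r i h₁ h₂, mul_assoc]
      exact hψ _

theorem gradedPart_le_straightPart (e : ℤ) : gradedPart K ℓ n e ≤ straightPart K ℓ n e := by
  refine Submodule.span_le.2 ?_
  rintro _ ⟨G, rfl, rfl⟩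
  induction G with
  | nil => exact Submodule.subset_span ⟨[], [], by simp, by simp [psiWord, yWord]⟩
  | cons g G ih =>
    rw [List.map_cons, List.map_cons, List.sum_cons, List.prod_cons, add_comm]
    cases g with
    | psi r => exact psi_mul_mem_straightPart K ℓ r ih
    | y i => exact y_mul_mem_straightPart K ℓ i ih

theorem span_words_eq_top : Submodule.span K (Set.range fun G : List (NilHeckeGen n) =>
    (G.map (gen K ℓ)).prod) = ⊤ := by
  classical
  rw [eq_top_iff]
  rintro x -
  rw [← DirectSum.sum_support_decompose (gradedPart K ℓ n) x]
  refine sum_mem fun e _ => ?_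
  refine (Submodule.span_mono ?_ : gradedPart K ℓ n e ≤ _) (SetLike.coe_mem _)
  rintro _ ⟨G, -, rfl⟩
  exact ⟨G, rfl⟩

theorem yWord_mul_yTop (M : List (Fin n)) (hM : M ≠ []) : yWord K n M * yTop K n n = 0 := by
  obtain ⟨M, i, rfl⟩ : ∃ M' i, M = M' ++ [i] := by
    rcases M.eq_nil_or_concat with rfl | ⟨M', i, rfl⟩
    · exact absurd rfl hM
    · exact ⟨M', i, by simp⟩
  simp [yWord, mul_assoc, y_mul_yTop]

/-- In positive degree every straightened term `ψ_L y_M` has a nonempty `M`, whose last letter meets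
`Y` and kills it. -/
theorem mul_yTop_eq_zero {e : ℤ} (he : 0 < e) {x : CycloNilHecke K n n}
    (hx : x ∈ gradedPart K n n e) : x * yTop K n n = 0 := by
  refine (Submodule.span_le.2 ?_ : straightPart K n n e ≤
    LinearMap.ker (LinearMap.mulRight K (yTop K n n))) (gradedPart_le_straightPart K n e hx)
  rintro _ ⟨L, M, rfl, rfl⟩
  change psiWord K n L * yWord K n M * yTop K n n = 0
  rw [mul_assoc, yWord_mul_yTop, mul_zero]
  rintro rfl
  simp only [List.length_nil] at he
  omega

theorem mul_yTop_mem_span (x : CycloNilHecke K n n) :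
    x * yTop K n n ∈ Submodule.span K (Set.range fun w => psiPerm K n w * yTop K n n) := by
  classical
  rw [← DirectSum.sum_support_decompose (gradedPart K n n) x, Finset.sum_mul]
  refine sum_mem fun e _ => ?_
  refine (Submodule.span_le.2 ?_ : straightPart K n n e ≤ Submodule.comap
    (LinearMap.mulRight K (yTop K n n)) (Submodule.span K
      (Set.range fun w => psiPerm K n w * yTop K n n)))
    (gradedPart_le_straightPart K n e (SetLike.coe_mem _))
  rintro _ ⟨L, M, rfl, rfl⟩
  change psiWord K n L * yWord K n M * yTop K n n ∈ Submodule.span K _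
  rw [mul_assoc]
  by_cases hM : M = []
  · subst hM
    rw [yWord, List.map_nil, List.prod_nil, one_mul]
    rcases psiWord_eq_psiPerm_or_zero K n L with h | h
    · rw [h]; exact Submodule.subset_span ⟨_, rfl⟩
    · rw [h, zero_mul]; exact zero_mem _
  · rw [yWord_mul_yTop K M hM, mul_zero]; exact zero_mem _

/-! ### The anti-automorphism -/

/-- The anti-automorphism as a linear map. -/
noncomputable def antiStarLin (n : ℕ) : CycloNilHecke K ℓ n →ₗ[K] CycloNilHecke K ℓ n :=
  (MulOpposite.opLinearEquiv K).symm.toLinearMap ∘ₗ (starHom K ℓ).toLinearMap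

theorem antiStarLin_apply (x : CycloNilHecke K ℓ n) : antiStarLin K ℓ n x = antiStar K ℓ x := rfl

theorem antiStar_antiStar (x : CycloNilHecke K ℓ n) : antiStar K ℓ (antiStar K ℓ x) = x := by
  have hx : x ∈ Submodule.span K (Set.range fun G : List (NilHeckeGen n) =>
      (G.map (gen K ℓ)).prod) := by rw [span_words_eq_top]; trivial
  have h1 : antiStar K ℓ (1 : CycloNilHecke K ℓ n) = 1 := by simp [antiStar]
  refine (Submodule.span_le.2 ?_ : _ ≤ LinearMap.eqLocus
    (antiStarLin K ℓ n ∘ₗ antiStarLin K ℓ n) LinearMap.id) hx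
  rintro _ ⟨G, rfl⟩
  change antiStar K ℓ (antiStar K ℓ _) = (G.map (gen K ℓ)).prod
  induction G with
  | nil => simp [h1]
  | cons g G ih => simp [antiStar_mul, antiStar_gen, ih]

theorem antiStar_evalY (p : MvPolynomial (Fin n) K) :
    antiStar K ℓ (evalY K ℓ p) = evalY K ℓ p := by
  induction p using MvPolynomial.induction_on with
  | C c =>
    rw [← MvPolynomial.algebraMap_eq, AlgHom.commutes]
    simp [antiStar]
  | add p q hp hq =>
    rw [map_add, ← antiStarLin_apply, map_add, antiStarLin_apply, antiStarLin_apply, hp, hq]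
  | mul_X p i hp =>
    rw [map_mul, antiStar_mul, hp, ← evalY_mul_comm, evalY_X, y, antiStar_gen]

theorem yTop_mul_mem_span (x : CycloNilHecke K n n) :
    yTop K n n * x ∈ Submodule.span K (Set.range fun w => yTop K n n * psiPerm K n w) := by
  have h := mul_yTop_mem_span K (antiStar K n x)
  have h' := Submodule.mem_map_of_mem (f := antiStarLin K n n) h
  rw [antiStarLin_apply, antiStar_mul, antiStar_antiStar, yTop, yMon, antiStar_evalY,
    Submodule.map_span] at h'
  refine Submodule.span_mono ?_ h'
  rintro _ ⟨_, ⟨w, rfl⟩, rfl⟩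
  refine ⟨w⁻¹, ?_⟩
  simp only [antiStarLin_apply, antiStar_mul, antiStar_psiPerm, yTop, yMon, antiStar_evalY]

/-! ### The matrix units -/

/-- `Y` is built from `1` by raising one of two equal neighbouring exponents. Each raise prepends
`ψ_r` to the word: `y_r y^a ψ_r = (ψ_r y_{r+1} - 1) y^a`, and the first term dies against `ψ_L Y`,
leaving a sign. -/
theorem exists_psiWord_yTop :
    ∃ L : List (Fin (n - 1)), L.length = n * (n - 1) / 2 ∧
      yTop K n n * psiWord K n L * yTop K n n = (-1) ^ (n * (n - 1) / 2) * yTop K n n := by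
  rw [← sum_staircase]
  suffices h : ∃ L : List (Fin (n - 1)), L.length = ∑ i : Fin n, (n - 1 - i.1) ∧
      yTop K n n * psiWord K n L * yTop K n n = (-1) ^ L.length * yTop K n n by
    obtain ⟨L, hL, h⟩ := h
    exact ⟨L, hL, by rw [h, hL]⟩
  refine staircase_induction_top n (P := fun a => ∃ L : List (Fin (n - 1)),
    L.length = ∑ i : Fin n, a i ∧
      yMon K n n a * psiWord K n L * yTop K n n = (-1) ^ L.length * yTop K n n) ?_ ?_
  · exact ⟨[], by simp, by simp [yMon, psiWord]⟩
  · rintro a r hr ha ⟨L, hL, h⟩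
    let s : Fin (n - 1) := ⟨r, by omega⟩
    have hup : yMon K n n (Function.update a r (a r + 1)) = y K n (loIdx s) * yMon K n n a :=
      yMon_update K n a (loIdx s)
    have hup' : yMon K n n (Function.update a (r + 1) (a (r + 1) + 1)) =
        y K n (hiIdx s) * yMon K n n a := yMon_update K n a (hiIdx s)
    have hsum : ∀ i : Fin n, ∑ j : Fin n, Function.update a i (a i + 1) j =
        ∑ j : Fin n, a j + 1 := fun i => by
      rw [← Finset.add_sum_erase _ _ (Finset.mem_univ i),
        ← Finset.add_sum_erase _ (fun j : Fin n => a j) (Finset.mem_univ i), Function.update_self,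
        Finset.sum_congr rfl fun j hj => Function.update_of_ne
          (fun h => Finset.ne_of_mem_erase hj (Fin.ext h)) _ _]
      omega
    refine ⟨s :: L, by rw [List.length_cons, hL]; exact (hsum (loIdx s)).symm, ?_⟩
    -- As the length of `L` is the sum of the exponents `a`, the extra `y_{r+1}` puts the factor
    -- left of `Y` in degree `2`.
    have hz : y K n (hiIdx s) * yMon K n n a * psiWord K n L * yTop K n n = 0 := by
      refine mul_yTop_eq_zero K (e := 2) (by norm_num) ?_
      have h₁ := yMon_mem_gradedPart K n (n := n) (Function.update a (r + 1) (a (r + 1) + 1))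
      have h₃ := SetLike.GradedMul.mul_mem h₁ (psiWord_mem_gradedPart K n L)
      rw [hup'] at h₃
      convert h₃ using 2
      have := hsum (hiIdx s)
      rw [hL]
      change ∑ j : Fin n, Function.update a (r + 1) (a (r + 1) + 1) j = _ at this
      rw [← Nat.cast_sum, this]
      push_cast
      ring
    rw [hup, mul_assoc (y K n _), psiWord_cons, ← mul_assoc (yMon K n n a),
      ← yMon_psi_comm K n a s ha, ← mul_assoc, ← mul_assoc,
      ← sub_eq_of_eq_add (psi_y K n s), sub_mul, one_mul, sub_mul, sub_mul, h, mul_assoc (psi K n s),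
      mul_assoc (psi K n s), mul_assoc (psi K n s), hz, List.length_cons, pow_succ]
    have hneg : ∀ {R : Type _} [Ring R] (a b : R), 0 - a * b = a * -1 * b := by
      intros; rw [zero_sub, mul_neg_one, neg_mul]
    rw [mul_zero]
    exact hneg _ _

theorem yTop_psiWord_yTop (L : List (Fin (n - 1))) :
    yTop K n n * psiWord K n L * yTop K n n =
      if wordPerm L = longestPerm n ∧ L.length = n * (n - 1) / 2 then
        (-1) ^ (n * (n - 1) / 2) * yTop K n n else 0 := by
  -- Nonvanishing of `Y` is not yet known. When it holds, it forces the word `M` obtained below to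
  -- be reduced, hence to express `w₀`.
  by_cases h0 : yTop K n n = 0
  · simp [h0]
  rcases (numInv_wordPerm_le L).lt_or_eq with hL | hL
  · rw [psiWord_eq_zero_of_not_reduced K n L hL, if_neg, mul_zero, zero_mul]
    rintro ⟨h₁, h₂⟩
    rw [h₁, numInv_longestPerm] at hL
    omega
  have hle : L.length ≤ n * (n - 1) / 2 := by
    have := numInv_longestPerm_mul (wordPerm L)
    omega
  rcases hle.lt_or_eq with hlt | heq
  · rw [if_neg (by omega)]
    refine mul_yTop_eq_zero K (e := 2 * (n * (n - 1) / 2 : ℕ) + -2 * L.length) (by omega) ?_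
    exact SetLike.GradedMul.mul_mem (yTop_mem_gradedPart K n) (psiWord_mem_gradedPart K n L)
  · obtain ⟨M, hM, hMtop⟩ := exists_psiWord_yTop K (n := n)
    have hw : wordPerm L = longestPerm n := eq_longestPerm_of_numInv _ (by omega)
    have hMi : numInv (wordPerm M) = M.length := by
      refine (numInv_wordPerm_le M).lt_or_eq.resolve_left fun hlt => h0 ?_
      rw [psiWord_eq_zero_of_not_reduced K n M hlt, mul_zero, zero_mul] at hMtop
      rcases neg_one_pow_eq_or (CycloNilHecke K n n) (n * (n - 1) / 2) with h | h <;>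
        simpa [h] using hMtop.symm
    have hw' : wordPerm M = longestPerm n := eq_longestPerm_of_numInv _ (by omega)
    rw [if_pos ⟨hw, heq⟩, ← hMtop, psiWord_eq_of_reduced K n L M (by rw [hw, hw']) hL.symm
      (by omega)]

end CycloNilHecke

/-! ### Divided differences -/

namespace DividedDifference

open MvPolynomial

variable (K : Type*) [Field K] {n : ℕ}

/-- The action of `s_r` on polynomials. -/
noncomputable def reflect (r : Fin (n - 1)) : MvPolynomial (Fin n) K →ₐ[K] MvPolynomial (Fin n) K :=
  rename (simpleRefl r)

/-- The difference of the variables exchanged by `s_r`. -/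
noncomputable def root (r : Fin (n - 1)) : MvPolynomial (Fin n) K := X (loIdx r) - X (hiIdx r)

theorem reflect_X (r : Fin (n - 1)) (i : Fin n) :
    reflect K r (X i : MvPolynomial (Fin n) K) = X (simpleRefl r i) :=
  rename_X _ _

theorem root_ne_zero (r : Fin (n - 1)) : root K r ≠ 0 :=
  sub_ne_zero.2 fun h => (loIdx_lt_hiIdx r).ne (X_injective h)

theorem reflect_reflect (r : Fin (n - 1)) (f : MvPolynomial (Fin n) K) :
    reflect K r (reflect K r f) = f := by
  have h : (simpleRefl r : Fin n → Fin n) ∘ simpleRefl r = id := by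
    rw [← Equiv.Perm.coe_mul, simpleRefl_mul_self, Equiv.Perm.coe_one]
  rw [reflect, rename_rename, h, rename_id_apply]

theorem reflect_comm (r k : Fin (n - 1)) (h : k.1 + 1 < r.1) (f : MvPolynomial (Fin n) K) :
    reflect K r (reflect K k f) = reflect K k (reflect K r f) := by
  rw [reflect, reflect, rename_rename, rename_rename, ← Equiv.Perm.coe_mul, ← Equiv.Perm.coe_mul,
    CycloNilHecke.simpleRefl_comm k r h]

theorem reflect_braid (r k : Fin (n - 1)) (h : k.1 = r.1 + 1) (f : MvPolynomial (Fin n) K) :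
    reflect K r (reflect K k (reflect K r f)) = reflect K k (reflect K r (reflect K k f)) := by
  simp only [reflect, rename_rename, ← Equiv.Perm.coe_mul]
  rw [← mul_assoc, ← mul_assoc, CycloNilHecke.simpleRefl_braid r k h]

/-- Modulo `X_r - X_{r+1}` the reflection acts as the identity on the variables. -/
theorem root_dvd (r : Fin (n - 1)) (f : MvPolynomial (Fin n) K) :
    root K r ∣ reflect K r f - f := by
  rw [← Ideal.mem_span_singleton, ← Ideal.Quotient.eq]
  have h : (Ideal.Quotient.mkₐ K (Ideal.span {root K r})).comp (reflect K r) =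
      Ideal.Quotient.mkₐ K (Ideal.span {root K r}) := by
    have hr : (Ideal.Quotient.mk (Ideal.span {root K r})) (X (loIdx r)) =
        Ideal.Quotient.mk (Ideal.span {root K r}) (X (hiIdx r)) :=
      Ideal.Quotient.eq.2 (Ideal.mem_span_singleton_self _)
    refine algHom_ext fun i => ?_
    rw [AlgHom.comp_apply, reflect_X, Ideal.Quotient.mkₐ_eq_mk]
    by_cases h₁ : i = loIdx r
    · rw [h₁, simpleRefl_loIdx, hr]
    by_cases h₂ : i = hiIdx r
    · rw [h₂, simpleRefl_hiIdx, hr]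
    rw [simpleRefl_of_ne r i h₁ h₂]
  exact DFunLike.congr_fun h f

theorem root_mul_choose (r : Fin (n - 1)) (f : MvPolynomial (Fin n) K) :
    root K r * Classical.choose (root_dvd K r f) = reflect K r f - f :=
  (Classical.choose_spec (root_dvd K r f)).symm

/-- The divided difference `(s_r f - f) / (X_r - X_{r+1})`. -/
noncomputable def divDiff (r : Fin (n - 1)) :
    MvPolynomial (Fin n) K →ₗ[K] MvPolynomial (Fin n) K where
  toFun f := Classical.choose (root_dvd K r f)
  map_add' f g := mul_left_cancel₀ (root_ne_zero K r) (by
    rw [mul_add, root_mul_choose, root_mul_choose, root_mul_choose, map_add]; ring)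
  map_smul' c f := mul_left_cancel₀ (root_ne_zero K r) (by
    rw [root_mul_choose, RingHom.id_apply, mul_smul_comm, root_mul_choose, map_smul, smul_sub])

theorem root_mul_divDiff (r : Fin (n - 1)) (f : MvPolynomial (Fin n) K) :
    root K r * divDiff K r f = reflect K r f - f :=
  root_mul_choose K r f

theorem divDiff_eq (r : Fin (n - 1)) (f g : MvPolynomial (Fin n) K)
    (h : root K r * g = reflect K r f - f) : divDiff K r f = g :=
  mul_left_cancel₀ (root_ne_zero K r) (by rw [root_mul_divDiff, h])

theorem divDiff_mul (r : Fin (n - 1)) (f g : MvPolynomial (Fin n) K) :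
    divDiff K r (f * g) = divDiff K r f * g + reflect K r f * divDiff K r g := by
  refine divDiff_eq K r _ _ ?_
  rw [map_mul]
  linear_combination g * root_mul_divDiff K r f + reflect K r f * root_mul_divDiff K r g

theorem divDiff_loIdx (r : Fin (n - 1)) : divDiff K r (X (loIdx r)) = -1 :=
  divDiff_eq K r _ _ (by rw [reflect_X, simpleRefl_loIdx, root]; ring)

theorem divDiff_hiIdx (r : Fin (n - 1)) : divDiff K r (X (hiIdx r)) = 1 :=
  divDiff_eq K r _ _ (by rw [reflect_X, simpleRefl_hiIdx, root]; ring)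

theorem divDiff_of_ne (r : Fin (n - 1)) (i : Fin n) (h₁ : i ≠ loIdx r) (h₂ : i ≠ hiIdx r) :
    divDiff K r (X i) = 0 :=
  divDiff_eq K r _ _ (by rw [reflect_X, simpleRefl_of_ne r i h₁ h₂]; ring)

theorem divDiff_divDiff (r : Fin (n - 1)) (f : MvPolynomial (Fin n) K) :
    divDiff K r (divDiff K r f) = 0 := by
  have hroot : reflect K r (root K r) = -root K r := by
    rw [root, map_sub, reflect_X, reflect_X, simpleRefl_loIdx, simpleRefl_hiIdx]; ring
  have h := congrArg (reflect K r) (root_mul_divDiff K r f)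
  rw [map_mul, map_sub, reflect_reflect, hroot] at h
  refine divDiff_eq K r _ _ (mul_left_cancel₀ (root_ne_zero K r) ?_)
  linear_combination h + root_mul_divDiff K r f

theorem reflect_divDiff (r : Fin (n - 1)) (f : MvPolynomial (Fin n) K) :
    reflect K r (divDiff K r f) = divDiff K r f := by
  have h := root_mul_divDiff K r (divDiff K r f)
  rw [divDiff_divDiff, mul_zero] at h
  exact (sub_eq_zero.1 h.symm)

theorem reflect_root_of_far (r k : Fin (n - 1)) (h : r.1 + 1 < k.1 ∨ k.1 + 1 < r.1) :
    reflect K r (root K k) = root K k := by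
  rw [root, map_sub, reflect_X, reflect_X, simpleRefl_of_ne, simpleRefl_of_ne] <;>
    simp [loIdx, hiIdx, Fin.ext_iff] <;> omega

theorem divDiff_comm (r k : Fin (n - 1)) (h : k.1 + 1 < r.1) (f : MvPolynomial (Fin n) K) :
    divDiff K r (divDiff K k f) = divDiff K k (divDiff K r f) := by
  have h₁ := congrArg (reflect K r) (root_mul_divDiff K k f)
  have h₂ := congrArg (reflect K k) (root_mul_divDiff K r f)
  rw [map_mul, map_sub, reflect_root_of_far K r k (Or.inr h)] at h₁
  rw [map_mul, map_sub, reflect_root_of_far K k r (Or.inl h), ← reflect_comm K r k h] at h₂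
  refine mul_left_cancel₀ (mul_ne_zero (root_ne_zero K r) (root_ne_zero K k)) ?_
  linear_combination root K k * root_mul_divDiff K r (divDiff K k f) -
    root K r * root_mul_divDiff K k (divDiff K r f) + h₁ - h₂ - root_mul_divDiff K k f +
    root_mul_divDiff K r f

/-- The product of three divided differences as an alternating sum, for abstract data. -/
theorem alternating_sum_of_divDiff {R : Type*} [CommRing R] (s t : R →+* R) (a b : R)
    (hsa : s a = -a) (hsb : s b = a + b) (hta : t a = a + b) (f g h k : R) (hsg : s g = g)
    (hg : a * g = s f - f) (hh : b * h = t g - g) (hk : a * k = s h - h) :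
    a * b * (a + b) * k = s (t (s f)) - s (t f) - t (s f) + t f + s f - f := by
  have e₁ := congrArg t hg
  have e₂ := congrArg s hh
  have e₃ := congrArg s e₁
  simp only [map_mul, map_sub, map_add, hsa, hsb, hta] at e₁ e₂ e₃
  linear_combination b * (a + b) * hk + b * e₂ - (a + b) * hh + e₃ - e₁ + hg - b * hsg

/-- After multiplication by the three roots both sides become alternating sums over the group
generated by the two reflections; these agree because `s_r s_k s_r = s_k s_r s_k`. -/
theorem divDiff_braid (r k : Fin (n - 1)) (h : k.1 = r.1 + 1) (f : MvPolynomial (Fin n) K) :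
    divDiff K r (divDiff K k (divDiff K r f)) = divDiff K k (divDiff K r (divDiff K k f)) := by
  have hm : loIdx k = hiIdx r := by simp [loIdx, hiIdx, h]
  have h₁ : simpleRefl r (hiIdx k) = hiIdx k := by
    apply simpleRefl_of_ne <;> simp [loIdx, hiIdx, Fin.ext_iff] <;> omega
  have h₂ : simpleRefl k (loIdx r) = loIdx r := by
    apply simpleRefl_of_ne <;> simp [loIdx, hiIdx, Fin.ext_iff] <;> omega
  have h₃ : simpleRefl k (hiIdx r) = hiIdx k := by rw [← hm, simpleRefl_loIdx]
  have rr : reflect K r (root K r) = -root K r := by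
    rw [root, map_sub, reflect_X, reflect_X, simpleRefl_loIdx, simpleRefl_hiIdx]; ring
  have kk : reflect K k (root K k) = -root K k := by
    rw [root, map_sub, reflect_X, reflect_X, simpleRefl_loIdx, simpleRefl_hiIdx]; ring
  have rk : reflect K r (root K k) = root K r + root K k := by
    rw [root, root, map_sub, reflect_X, reflect_X, hm, h₁, simpleRefl_hiIdx]; ring
  have kr : reflect K k (root K r) = root K r + root K k := by
    rw [root, root, map_sub, reflect_X, reflect_X, h₂, h₃, hm]; ring
  have e₁ := alternating_sum_of_divDiff (reflect K r).toRingHom (reflect K k).toRingHom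
    (root K r) (root K k) rr rk kr f _ _ _ (reflect_divDiff K r f) (root_mul_divDiff K r _)
    (root_mul_divDiff K k _) (root_mul_divDiff K r _)
  have e₂ := alternating_sum_of_divDiff (reflect K k).toRingHom (reflect K r).toRingHom
    (root K k) (root K r) kk (by rw [add_comm]; exact kr)
    (by rw [add_comm]; exact rk) f _ _ _ (reflect_divDiff K k f) (root_mul_divDiff K k _)
    (root_mul_divDiff K r _) (root_mul_divDiff K k _)
  have e₃ := reflect_braid K r k h f
  have hne : root K r + root K k ≠ 0 := by
    rw [← rk]
    intro h0
    have := congrArg (reflect K r) h0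
    rw [reflect_reflect, map_zero] at this
    exact root_ne_zero K k this
  refine mul_left_cancel₀ (mul_ne_zero (mul_ne_zero (root_ne_zero K r) (root_ne_zero K k)) hne) ?_
  simp only [AlgHom.toRingHom_eq_coe, RingHom.coe_coe] at e₁ e₂
  linear_combination e₁ - e₂ + e₃

/-! ### The coinvariant algebra -/

/-- The ideal generated by the symmetric polynomials without constant term. -/
noncomputable def symmIdeal (n : ℕ) : Ideal (MvPolynomial (Fin n) K) :=
  Ideal.span {p | p.IsSymmetric ∧ constantCoeff p = 0}

theorem divDiff_mem_symmIdeal (r : Fin (n - 1)) (f : MvPolynomial (Fin n) K)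
    (hf : f ∈ symmIdeal K n) : divDiff K r f ∈ symmIdeal K n := by
  refine Submodule.span_induction (p := fun f _ => divDiff K r f ∈ symmIdeal K n) ?_ ?_ ?_ ?_ hf
  · rintro p ⟨hp, -⟩
    rw [divDiff_eq K r p 0 (by rw [reflect, hp]; ring)]
    exact zero_mem _
  · rw [map_zero]; exact zero_mem _
  · intro p q _ _ hp hq
    rw [map_add]; exact add_mem hp hq
  · intro a p hp hp'
    rw [smul_eq_mul, divDiff_mul]
    exact add_mem (Ideal.mul_mem_left _ _ hp) (Ideal.mul_mem_left _ _ hp')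

theorem one_notMem_symmIdeal : (1 : MvPolynomial (Fin n) K) ∉ symmIdeal K n := by
  intro h
  have hle : symmIdeal K n ≤ RingHom.ker constantCoeff :=
    Ideal.span_le.2 fun p hp => RingHom.mem_ker.2 hp.2
  have := RingHom.mem_ker.1 (hle h)
  simp at this

/-- Put `T = -X_i` in `∏ (T + X_j) = ∑ e_j T^{n-j}`: the product vanishes, and all terms with `j ≥
1` lie in the ideal. This gives the relation `y_1^n = 0` on the quotient. -/
theorem X_pow_mem_symmIdeal (i : Fin n) : (X i : MvPolynomial (Fin n) K) ^ n ∈ symmIdeal K n := by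
  have h := congrArg (Polynomial.eval (-X i : MvPolynomial (Fin n) K))
    (prod_C_add_X_eq_sum_esymm K (Fin n))
  rw [Polynomial.eval_prod, Polynomial.eval_finsetSum, Finset.prod_eq_zero (Finset.mem_univ i)
    (by simp), Finset.sum_range_succ'] at h
  have hmem : ∑ j ∈ Finset.range (Fintype.card (Fin n)), Polynomial.eval
      (-X i : MvPolynomial (Fin n) K) (Polynomial.C (esymm (Fin n) K (j + 1)) *
        Polynomial.X ^ (Fintype.card (Fin n) - (j + 1))) ∈ symmIdeal K n := by
    refine sum_mem fun j _ => ?_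
    rw [Polynomial.eval_mul, Polynomial.eval_C]
    refine Ideal.mul_mem_right _ _ (Ideal.subset_span ⟨esymm_isSymmetric _ _ _, ?_⟩)
    rw [esymm, map_sum]
    refine Finset.sum_eq_zero fun t ht => ?_
    rw [map_prod]
    obtain ⟨k, hk⟩ : t.Nonempty := Finset.card_pos.1 (by
      rw [(Finset.mem_powersetCard.1 ht).2]; omega)
    exact Finset.prod_eq_zero hk (constantCoeff_X ..)
  rw [eq_neg_of_add_eq_zero_left h.symm, neg_mem_iff] at hmem
  simp only [esymm_zero, map_one, one_mul, Nat.sub_zero, Polynomial.eval_pow, Polynomial.eval_X,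
    Fintype.card_fin] at hmem
  rw [neg_pow] at hmem
  rcases neg_one_pow_eq_or (MvPolynomial (Fin n) K) n with h' | h' <;> simpa [h'] using hmem

/-- The operators by which the generators act on polynomials. -/
noncomputable def genOp : NilHeckeGen n → Module.End K (MvPolynomial (Fin n) K)
  | .psi r => divDiff K r
  | .y i => LinearMap.mulLeft K (X i)

theorem genOp_mem (g : NilHeckeGen n) : (symmIdeal K n).restrictScalars K ≤
    ((symmIdeal K n).restrictScalars K).comap (genOp K g) := by
  intro f hf
  cases g with
  | psi r => exact divDiff_mem_symmIdeal K r f hf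
  | y i => exact Ideal.mul_mem_left _ _ hf

/-- The action of the free algebra on the coinvariant algebra. -/
noncomputable def freeAction (n : ℕ) : FreeAlgebra K (NilHeckeGen n) →ₐ[K]
    Module.End K (MvPolynomial (Fin n) K ⧸ (symmIdeal K n).restrictScalars K) :=
  FreeAlgebra.lift K fun g => Submodule.mapQ _ _ (genOp K g) (genOp_mem K g)

theorem freeAction_psi (r : Fin (n - 1)) (f : MvPolynomial (Fin n) K) :
    freeAction K n (freePsi K r) (Submodule.Quotient.mk f) =
      Submodule.Quotient.mk (divDiff K r f) := by
  rw [freeAction, freePsi, FreeAlgebra.lift_ι_apply]; rfl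

theorem freeAction_y (i : Fin n) (f : MvPolynomial (Fin n) K) :
    freeAction K n (freeY K i) (Submodule.Quotient.mk f) = Submodule.Quotient.mk (X i * f) := by
  rw [freeAction, freeY, FreeAlgebra.lift_ι_apply]; rfl

theorem freeAction_y_pow (i : Fin n) (m : ℕ) (f : MvPolynomial (Fin n) K) :
    freeAction K n (freeY K i ^ m) (Submodule.Quotient.mk f) =
      Submodule.Quotient.mk (X i ^ m * f) := by
  induction m with
  | zero => simp
  | succ m ih => rw [pow_succ', map_mul, Module.End.mul_apply, ih, freeAction_y, pow_succ', mul_assoc]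

theorem freeAction_rel {a b : FreeAlgebra K (NilHeckeGen n)} (h : CycloNilHeckeRel K n n a b) :
    freeAction K n a = freeAction K n b := by
  refine LinearMap.ext fun q => ?_
  obtain ⟨f, rfl⟩ := Submodule.Quotient.mk_surjective _ q
  induction h with
  | psi_sq r =>
    simp only [map_mul, map_zero, Module.End.mul_apply, freeAction_psi, divDiff_divDiff]; rfl
  | psi_comm r k h =>
    simp only [map_mul, Module.End.mul_apply, freeAction_psi, divDiff_comm K r k h]
  | braid r k h =>
    simp only [map_mul, Module.End.mul_apply, freeAction_psi, divDiff_braid K r k h]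
  | y_comm i j =>
    simp only [map_mul, Module.End.mul_apply, freeAction_y, mul_left_comm]
  | psi_y_far r i h₁ h₂ =>
    simp only [map_mul, Module.End.mul_apply, freeAction_y, freeAction_psi, divDiff_mul,
      divDiff_of_ne K r i h₁ h₂, reflect_X, simpleRefl_of_ne r i h₁ h₂, zero_mul, zero_add]
  | psi_y r =>
    simp only [map_mul, map_add, map_one, Module.End.mul_apply, LinearMap.add_apply,
      Module.End.one_apply, freeAction_y, freeAction_psi, divDiff_mul, divDiff_hiIdx, reflect_X,
      simpleRefl_hiIdx, one_mul, ← Submodule.Quotient.mk_add]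
    rw [add_comm]
  | y_psi r =>
    simp only [map_mul, map_add, map_one, Module.End.mul_apply, LinearMap.add_apply,
      Module.End.one_apply, freeAction_y, freeAction_psi, divDiff_mul, divDiff_loIdx, reflect_X,
      simpleRefl_loIdx, ← Submodule.Quotient.mk_add]
    congr 1
    ring
  | cyclotomic i h =>
    rw [freeAction_y_pow, map_zero, LinearMap.zero_apply, Submodule.Quotient.mk_eq_zero]
    exact Ideal.mul_mem_right _ _ (X_pow_mem_symmIdeal K i)

theorem nontrivial_cycloNilHecke (n : ℕ) : Nontrivial (CycloNilHecke K n n) := by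
  have hQ : Nontrivial (MvPolynomial (Fin n) K ⧸ (symmIdeal K n).restrictScalars K) := by
    refine ⟨Submodule.Quotient.mk 1, 0, fun h => one_notMem_symmIdeal K (n := n) ?_⟩
    exact (Submodule.Quotient.mk_eq_zero _).1 h
  exact (RingQuot.liftAlgHom K ⟨freeAction K n, fun _ _ => freeAction_rel K⟩ :
    CycloNilHecke K n n →ₐ[K] _).toRingHom.domain_nontrivial

end DividedDifference

/-! ### Algebras with a spanning system of matrix units -/

section MatrixUnits

variable {K A ι : Type*} [Field K] [Ring A] [Algebra K A] [Fintype ι] [DecidableEq ι]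
  (F : ι → ι → A)

theorem sum_diag_eq_one
    (hmul : ∀ i j k l, F i j * F k l = if j = k then F i l else 0)
    (hspan : Submodule.span K (Set.range fun p : ι × ι => F p.1 p.2) = ⊤) :
    ∑ i, F i i = 1 := by
  have h : ∀ x : A, (∑ i, F i i) * x = x := fun x => by
    have hx : x ∈ Submodule.span K (Set.range fun p : ι × ι => F p.1 p.2) := by
      rw [hspan]; trivial
    refine (Submodule.span_le.2 ?_ : _ ≤ LinearMap.eqLocus
      (LinearMap.mulLeft K (∑ i, F i i)) LinearMap.id) hx
    rintro _ ⟨⟨i, j⟩, rfl⟩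
    change (∑ i, F i i) * F i j = F i j
    simp [Finset.sum_mul, hmul]
  rw [← h 1, mul_one]

/-- The homomorphism from the matrix algebra given by a system of matrix units. -/
noncomputable def matrixUnitsHom
    (hmul : ∀ i j k l, F i j * F k l = if j = k then F i l else 0) (hone : ∑ i, F i i = 1) :
    Matrix ι ι K →ₐ[K] A :=
  AlgHom.ofLinearMap
    { toFun := fun M => ∑ i, ∑ j, M i j • F i j
      map_add' := fun M N => by simp [add_smul, Finset.sum_add_distrib]
      map_smul' := fun c M => by simp [mul_smul, Finset.smul_sum] }
    (by simp [Matrix.one_apply, hone])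
    (by
      intro M N
      simp only [LinearMap.coe_mk, AddHom.coe_mk, Finset.sum_mul, Finset.mul_sum, smul_mul_smul_comm,
        hmul, smul_ite, smul_zero, Matrix.mul_apply, Finset.sum_smul]
      rw [Finset.sum_congr rfl fun i _ => Finset.sum_comm, Finset.sum_comm]
      refine Finset.sum_congr rfl fun k _ => ?_
      rw [Finset.sum_comm]
      refine Finset.sum_congr rfl fun j _ => ?_
      simp)

theorem matrixUnitsHom_apply
    (hmul : ∀ i j k l, F i j * F k l = if j = k then F i l else 0) (hone : ∑ i, F i i = 1)
    (M : Matrix ι ι K) : matrixUnitsHom F hmul hone M = ∑ i, ∑ j, M i j • F i j := rfl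

theorem matrixUnitsHom_single
    (hmul : ∀ i j k l, F i j * F k l = if j = k then F i l else 0) (hone : ∑ i, F i i = 1)
    (i j : ι) : matrixUnitsHom F hmul hone (Matrix.single i j (1 : K)) = F i j := by
  rw [matrixUnitsHom_apply, Finset.sum_eq_single i, Finset.sum_eq_single j]
  · simp
  · intro k _ hk; simp [hk.symm]
  · simp
  · intro k _ hk; exact Finset.sum_eq_zero fun l _ => by simp [hk.symm]
  · simp

theorem exists_algEquiv_matrix [Nontrivial A]
    (hmul : ∀ i j k l, F i j * F k l = if j = k then F i l else 0)
    (hspan : Submodule.span K (Set.range fun p : ι × ι => F p.1 p.2) = ⊤) :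
    ∃ Φ : A ≃ₐ[K] Matrix ι ι K, ∀ i j, Φ (F i j) = Matrix.single i j 1 := by
  have hone := sum_diag_eq_one (K := K) F hmul hspan
  have hne : Nonempty ι := by
    by_contra hcon
    rw [not_nonempty_iff] at hcon
    exact zero_ne_one (α := A) (by rw [← hone]; simp)
  have hsurj : Function.Surjective (matrixUnitsHom (K := K) F hmul hone) := by
    rw [← AlgHom.coe_toLinearMap, ← LinearMap.range_eq_top, eq_top_iff, ← hspan, Submodule.span_le]
    rintro _ ⟨⟨i, j⟩, rfl⟩
    exact ⟨Matrix.single i j 1, matrixUnitsHom_single F hmul hone i j⟩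
  -- A matrix algebra of positive size over a field is simple, and the target is nonzero.
  have hinj : Function.Injective (matrixUnitsHom (K := K) F hmul hone) :=
    RingHom.injective (matrixUnitsHom (K := K) F hmul hone).toRingHom
  refine ⟨(AlgEquiv.ofBijective _ ⟨hinj, hsurj⟩).symm, fun i j => ?_⟩
  rw [AlgEquiv.symm_apply_eq]
  exact (matrixUnitsHom_single F hmul hone i j).symm

theorem neg_one_pow_mul_eq_smul (N : ℕ) (x : A) : (-1) ^ N * x = ((-1) ^ N : K) • x := by
  rcases Nat.even_or_odd N with h | h <;> simp [h.neg_one_pow]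

end MatrixUnits

/-! ### Degree, products, span and nonvanishing of the `F_{z₁,z₂}` -/

theorem OneBoxShape.theta_lamMin {ℓ n : ℕ} (h : n ≤ ℓ) (i : Fin n) :
    (OneBoxShape.lamMin h).theta i = ℓ - n + i + 1 := by
  rw [OneBoxShape.theta, ← Finset.orderEmbOfFin_unique (OneBoxShape.lamMin h).2
    (f := fun i : Fin n => (⟨ℓ - n + i, by omega⟩ : Fin ℓ))]
  · intro i; simp only [OneBoxShape.lamMin, Finset.mem_filter, Finset.mem_univ, true_and]; omega
  · intro i j hij; have : i.1 < j.1 := hij; simp only [Fin.lt_def]; omega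

namespace CycloNilHecke

variable (K : Type*) [Field K] (ℓ : ℕ) {n : ℕ}

theorem yShape_lamMin (h : n ≤ ℓ) : yShape K ℓ (OneBoxShape.lamMin h) = yTop K ℓ n := by
  rw [yTop, yMon, ← List.prod_ofFn, map_list_prod, List.map_ofFn, yShape]
  congr 2
  funext i
  rw [Function.comp_apply, map_pow, evalY_X, OneBoxShape.theta_lamMin]
  congr 1
  omega

theorem matUnit_eq (h : n ≤ ℓ) (z₁ z₂ : Equiv.Perm (Fin n)) :
    matUnit K ℓ h z₁ z₂ = ((-1) ^ (n * (n - 1) / 2) : K) •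
      (psiPerm K ℓ (longestPerm n * z₁)⁻¹ * yTop K ℓ n * psiPerm K ℓ z₂) := by
  rw [matUnit, psiCell, antiStar_psiPerm, yShape_lamMin]
  exact neg_one_pow_mul_eq_smul _ _

theorem psiPerm_mem_gradedPart (w : Equiv.Perm (Fin n)) :
    psiPerm K ℓ w ∈ gradedPart K ℓ n (-2 * numInv w) := by
  rw [← length_reducedExpr w]
  exact psiWord_mem_gradedPart K ℓ _

theorem matUnit_mem_gradedPart (h : n ≤ ℓ) (z₁ z₂ : Equiv.Perm (Fin n)) :
    matUnit K ℓ h z₁ z₂ ∈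
      gradedPart K ℓ n (2 * (permLength z₁ : ℤ) - 2 * (permLength z₂ : ℤ)) := by
  rw [matUnit_eq]
  refine Submodule.smul_mem _ _ ?_
  have h₁ := SetLike.GradedMul.mul_mem (SetLike.GradedMul.mul_mem
    (psiPerm_mem_gradedPart K ℓ (longestPerm n * z₁)⁻¹) (yTop_mem_gradedPart K ℓ))
    (psiPerm_mem_gradedPart K ℓ z₂)
  convert h₁ using 2
  have := numInv_longestPerm_mul z₁
  rw [permLength_eq_numInv, permLength_eq_numInv, numInv_inv]
  omega

theorem matUnit_mul_matUnit (z₁ z₂ u₁ u₂ : Equiv.Perm (Fin n)) :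
    matUnit K n le_rfl z₁ z₂ * matUnit K n le_rfl u₁ u₂ =
      if z₂ = u₁ then matUnit K n le_rfl z₁ u₂ else 0 := by
  have hw : wordPerm (reducedExpr z₂ ++ reducedExpr (longestPerm n * u₁)⁻¹) =
      z₂ * u₁⁻¹ * longestPerm n := by
    rw [wordPerm_append, wordPerm_reducedExpr, wordPerm_reducedExpr, mul_inv_rev, mul_assoc,
      inv_eq_of_mul_eq_one_right (longestPerm_mul_self n)]
  have hl : (reducedExpr z₂ ++ reducedExpr (longestPerm n * u₁)⁻¹).length + numInv u₁ =
      numInv z₂ + n * (n - 1) / 2 := by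
    rw [List.length_append, length_reducedExpr, length_reducedExpr, numInv_inv, add_assoc,
      numInv_longestPerm_mul]
  have hmid : yTop K n n * (psiPerm K n z₂ * psiPerm K n (longestPerm n * u₁)⁻¹) * yTop K n n =
      if z₂ = u₁ then ((-1) ^ (n * (n - 1) / 2) : K) • yTop K n n else 0 := by
    have h := yTop_psiWord_yTop K (reducedExpr z₂ ++ reducedExpr (longestPerm n * u₁)⁻¹)
    rw [psiWord_append, hw] at h
    refine h.trans ?_
    by_cases hz : z₂ = u₁
    · subst hz
      rw [if_pos rfl, if_pos ⟨by simp, by omega⟩]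
      exact neg_one_pow_mul_eq_smul _ _
    · rw [if_neg hz, if_neg]
      rintro ⟨h₁, -⟩
      rw [mul_eq_right, mul_inv_eq_one] at h₁
      exact hz h₁
  have hassoc : ∀ {R : Type _} [Ring R] (a t b c d : R),
      a * t * b * (c * t * d) = a * (t * (b * c) * t) * d := by
    intros; simp only [mul_assoc]
  rw [matUnit_eq, matUnit_eq, matUnit_eq, smul_mul_smul_comm]
  refine (congrArg _ ((hassoc _ _ _ _ _).trans (by rw [hmid]))).trans ?_
  have hsq : ((-1) ^ (n * (n - 1) / 2) : K) * (-1) ^ (n * (n - 1) / 2) = 1 := by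
    rw [← mul_pow]; simp
  split_ifs with hz
  · rw [mul_smul_comm, smul_mul_assoc, smul_smul, hsq, one_mul]
  · rw [mul_zero, zero_mul, smul_zero]

/-- The staircase is descended inside the ideal `J`. Suppose `y_r y^a ∈ J` and `y^a` commutes with
`ψ_r`. Multiplying by `ψ_r` on both sides gives `-ψ_r y^a ∈ J`, and `y^a = y_{r+1} ψ_r y^a - ψ_r y_r
y^a` then lies in `J`. -/
theorem one_mem_span_mul_yTop_mul : (1 : CycloNilHecke K n n) ∈
    Submodule.span K {x | ∃ a b : CycloNilHecke K n n, a * yTop K n n * b = x} := by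
  set J := Submodule.span K {x | ∃ a b : CycloNilHecke K n n, a * yTop K n n * b = x}
  have hl : ∀ (c : CycloNilHecke K n n) {x}, x ∈ J → c * x ∈ J := fun c x hx => by
    refine (Submodule.span_le.2 ?_ : J ≤ J.comap (LinearMap.mulLeft K c)) hx
    rintro _ ⟨a, b, rfl⟩
    refine Submodule.subset_span ⟨c * a, b, ?_⟩
    rw [mul_assoc c, mul_assoc c]; rfl
  have hr : ∀ (c : CycloNilHecke K n n) {x}, x ∈ J → x * c ∈ J := fun c x hx => by
    refine (Submodule.span_le.2 ?_ : J ≤ J.comap (LinearMap.mulRight K c)) hx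
    rintro _ ⟨a, b, rfl⟩
    refine Submodule.subset_span ⟨a, b * c, ?_⟩
    rw [← mul_assoc]; rfl
  -- Taking an implication as the predicate lets the ascending induction carry out a descent.
  have key := staircase_induction_top n
    (P := fun a => yMon K n n a ∈ J → (1 : CycloNilHecke K n n) ∈ J) ?_ ?_
  · exact key (Submodule.subset_span ⟨1, 1, by rw [one_mul, mul_one]; rfl⟩)
  · intro h; simpa [yMon] using h
  · intro a r hrn ha ih h
    refine ih ?_
    let s : Fin (n - 1) := ⟨r, by omega⟩
    have hup : yMon K n n (Function.update a r (a r + 1)) = y K n (loIdx s) * yMon K n n a :=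
      yMon_update K n a (loIdx s)
    have hc : psi K n s * yMon K n n a = yMon K n n a * psi K n s := yMon_psi_comm K n a s ha
    rw [hup] at h
    have h₁ : psi K n s * (y K n (loIdx s) * yMon K n n a) =
        y K n (hiIdx s) * (psi K n s * yMon K n n a) - yMon K n n a := by
      rw [← mul_assoc, ← mul_assoc, y_psi, add_mul, one_mul, add_sub_cancel_right]
    have h₂ : psi K n s * (y K n (loIdx s) * yMon K n n a) * psi K n s =
        -(psi K n s * yMon K n n a) := by
      rw [h₁, hc, sub_mul, mul_assoc (y K n _), mul_assoc (yMon K n n a), psi_sq, mul_zero,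
        mul_zero, zero_sub]
    have h₃ : psi K n s * yMon K n n a ∈ J := by
      rw [← neg_mem_iff]
      exact h₂ ▸ hr _ (hl _ h)
    have h₄ := sub_mem (hl (y K n (hiIdx s)) h₃) (hl (psi K n s) h)
    rwa [h₁, sub_sub_cancel] at h₄

theorem psiPerm_mul_yTop_mul_psiPerm_mem (w u : Equiv.Perm (Fin n)) :
    psiPerm K n w * yTop K n n * psiPerm K n u ∈ Submodule.span K
      (Set.range fun p : Equiv.Perm (Fin n) × Equiv.Perm (Fin n) => matUnit K n le_rfl p.1 p.2) := by
  have h := matUnit_eq K n le_rfl ((longestPerm n)⁻¹ * w⁻¹) u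
  rw [mul_inv_cancel_left, inv_inv] at h
  have hsq : ((-1) ^ (n * (n - 1) / 2) : K) * (-1) ^ (n * (n - 1) / 2) = 1 := by
    rw [← mul_pow]; simp
  rw [← one_smul K (psiPerm K n w * yTop K n n * psiPerm K n u), ← hsq, mul_smul, ← h]
  exact Submodule.smul_mem _ _ (Submodule.subset_span ⟨(_, _), rfl⟩)

theorem span_matUnit_eq_top : Submodule.span K
    (Set.range fun p : Equiv.Perm (Fin n) × Equiv.Perm (Fin n) => matUnit K n le_rfl p.1 p.2) =
      ⊤ := by
  set V := Submodule.span K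
    (Set.range fun p : Equiv.Perm (Fin n) × Equiv.Perm (Fin n) => matUnit K n le_rfl p.1 p.2)
  have h₁ : ∀ w b, psiPerm K n w * yTop K n n * b ∈ V := fun w b => by
    rw [mul_assoc]
    refine (Submodule.span_le.2 ?_ : _ ≤ V.comap (LinearMap.mulLeft K (psiPerm K n w)))
      (yTop_mul_mem_span K b)
    rintro _ ⟨u, rfl⟩
    change psiPerm K n w * (yTop K n n * psiPerm K n u) ∈ V
    rw [← mul_assoc]
    exact psiPerm_mul_yTop_mul_psiPerm_mem K w u
  have h₂ : ∀ a b, a * yTop K n n * b ∈ V := fun a b => by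
    refine (Submodule.span_le.2 ?_ : _ ≤ V.comap (LinearMap.mulRight K b)) (mul_yTop_mem_span K a)
    rintro _ ⟨w, rfl⟩
    exact h₁ w b
  have h₃ : (1 : CycloNilHecke K n n) ∈ V :=
    (Submodule.span_le.2 (by rintro _ ⟨a, b, rfl⟩; exact h₂ a b)) (one_mem_span_mul_yTop_mul K)
  rw [eq_top_iff]
  rintro x -
  have hx : ∀ c ∈ V, x * c ∈ V := fun c hc => by
    refine (Submodule.span_le.2 ?_ : V ≤ V.comap (LinearMap.mulLeft K x)) hc
    rintro _ ⟨⟨z₁, z₂⟩, rfl⟩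
    change x * matUnit K n le_rfl z₁ z₂ ∈ V
    rw [matUnit_eq, mul_smul_comm, ← mul_assoc, ← mul_assoc]
    exact V.smul_mem _ (h₂ _ _)
  simpa using hx 1 h₃

/-- The projection to the cyclotomic quotient with `ℓ = n`. -/
noncomputable def toTop (h : n ≤ ℓ) : CycloNilHecke K ℓ n →ₐ[K] CycloNilHecke K n n :=
  RingQuot.liftAlgHom K ⟨RingQuot.mkAlgHom K (CycloNilHeckeRel K n n), by
    intro a b hab
    induction hab with
    | psi_sq r => exact RingQuot.mkAlgHom_rel K (.psi_sq r)
    | psi_comm r k h => exact RingQuot.mkAlgHom_rel K (.psi_comm r k h)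
    | braid r k h => exact RingQuot.mkAlgHom_rel K (.braid r k h)
    | y_comm i j => exact RingQuot.mkAlgHom_rel K (.y_comm i j)
    | psi_y_far r i h₁ h₂ => exact RingQuot.mkAlgHom_rel K (.psi_y_far r i h₁ h₂)
    | psi_y r => exact RingQuot.mkAlgHom_rel K (.psi_y r)
    | y_psi r => exact RingQuot.mkAlgHom_rel K (.y_psi r)
    | cyclotomic i hi =>
      rw [map_pow, mk_freeY, map_zero, ← Nat.sub_add_cancel h, pow_add, cyclotomic K n i hi,
        mul_zero]⟩

theorem toTop_gen (h : n ≤ ℓ) (g : NilHeckeGen n) : toTop K ℓ h (gen K ℓ g) = gen K n g := by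
  simp [toTop, gen]

theorem toTop_matUnit (h : n ≤ ℓ) (z₁ z₂ : Equiv.Perm (Fin n)) :
    toTop K ℓ h (matUnit K ℓ h z₁ z₂) = matUnit K n le_rfl z₁ z₂ := by
  have hψ : ∀ w : Equiv.Perm (Fin n), toTop K ℓ h (psiPerm K ℓ w) = psiPerm K n w := fun w => by
    rw [psiPerm, map_list_prod, List.map_map, psiPerm]
    congr 1
    exact List.map_congr_left fun r _ => toTop_gen K ℓ h (.psi r)
  have hy : (toTop K ℓ h).comp (evalY K ℓ) = evalY K n := by
    refine MvPolynomial.algHom_ext fun i => ?_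
    rw [AlgHom.comp_apply, evalY_X, evalY_X]
    exact toTop_gen K ℓ h (.y i)
  have hy' : toTop K ℓ h (yTop K ℓ n) = yTop K n n := DFunLike.congr_fun hy _
  rw [matUnit_eq, matUnit_eq, map_smul, map_mul, map_mul, hψ, hψ, hy']

/-- If one unit vanished for `ℓ = n`, then so would every `F_{u,w} = F_{u,z₁} F_{z₁,z₂} F_{z₂,w}`,
and with them their diagonal sum `1`. -/
theorem matUnit_ne_zero (h : n ≤ ℓ) (z₁ z₂ : Equiv.Perm (Fin n)) : matUnit K ℓ h z₁ z₂ ≠ 0 := by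
  intro h0
  have h1 : matUnit K n le_rfl z₁ z₂ = 0 := by rw [← toTop_matUnit K ℓ h, h0, map_zero]
  have hall : ∀ u w : Equiv.Perm (Fin n), matUnit K n le_rfl u w = 0 := fun u w => by
    have e₁ := matUnit_mul_matUnit K u z₁ z₁ z₂
    have e₂ := matUnit_mul_matUnit K u z₂ z₂ w
    rw [if_pos rfl] at e₁ e₂
    rw [← e₂, ← e₁, h1, mul_zero, zero_mul]
  have hone := sum_diag_eq_one (K := K) (matUnit K n le_rfl) (matUnit_mul_matUnit K)
    (span_matUnit_eq_top K)
  have := DividedDifference.nontrivial_cycloNilHecke K n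
  refine zero_ne_one (α := CycloNilHecke K n n) ?_
  rw [← hone, Finset.sum_eq_zero fun w _ => hall w w]

end CycloNilHecke

theorem mainTheorem8 (K : Type*) [Field K] (ℓ n : ℕ) (hnℓ : n ≤ ℓ) :
    (∀ z₁ z₂ : Equiv.Perm (Fin n),
      CycloNilHecke.matUnit K ℓ hnℓ z₁ z₂ ≠ 0 ∧
      CycloNilHecke.matUnit K ℓ hnℓ z₁ z₂ ∈
        CycloNilHecke.gradedPart K ℓ n (2 * (permLength z₁ : ℤ) - 2 * (permLength z₂ : ℤ))) ∧
    (ℓ = n →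
      ((∑ w : Equiv.Perm (Fin n), CycloNilHecke.matUnit K ℓ hnℓ w w) = 1) ∧
      (∀ z₁ z₂ u₁ u₂ : Equiv.Perm (Fin n),
        CycloNilHecke.matUnit K ℓ hnℓ z₁ z₂ * CycloNilHecke.matUnit K ℓ hnℓ u₁ u₂ =
          if z₂ = u₁ then CycloNilHecke.matUnit K ℓ hnℓ z₁ u₂ else 0) ∧
      ∃ (e : Equiv.Perm (Fin n) ≃ Fin (n !))
        (Φ : CycloNilHecke K ℓ n ≃ₐ[K] Matrix (Fin (n !)) (Fin (n !)) K),
        ∀ u w : Equiv.Perm (Fin n),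
          Φ (CycloNilHecke.matUnit K ℓ hnℓ u w) = Matrix.single (e u) (e w) 1) := by
  refine ⟨fun z₁ z₂ => ⟨CycloNilHecke.matUnit_ne_zero K ℓ hnℓ z₁ z₂,
    CycloNilHecke.matUnit_mem_gradedPart K ℓ hnℓ z₁ z₂⟩, ?_⟩
  rintro rfl
  have := DividedDifference.nontrivial_cycloNilHecke K ℓ
  obtain ⟨Φ, hΦ⟩ := exists_algEquiv_matrix (K := K) (CycloNilHecke.matUnit K ℓ le_rfl)
    (CycloNilHecke.matUnit_mul_matUnit K) (CycloNilHecke.span_matUnit_eq_top K)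
  have e : Equiv.Perm (Fin ℓ) ≃ Fin (ℓ !) :=
    Fintype.equivFinOfCardEq (by rw [Fintype.card_perm, Fintype.card_fin])
  refine ⟨sum_diag_eq_one (K := K) (CycloNilHecke.matUnit K ℓ le_rfl)
    (CycloNilHecke.matUnit_mul_matUnit K) (CycloNilHecke.span_matUnit_eq_top K),
    CycloNilHecke.matUnit_mul_matUnit K, e, Φ.trans (Matrix.reindexAlgEquiv K K e), fun u w => ?_⟩
  rw [AlgEquiv.trans_apply, hΦ, Matrix.coe_reindexAlgEquiv, Matrix.reindex_apply,
    Matrix.submatrix_single_equiv]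
  simp
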